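/- **Setting.** There are $M\ge 1$ clients; client $m$ holds $n\ge1$ samples $(x_{mi},y_{mi})$, $x_{mi}\in\mathbb R^d$, $\|x_{mi}\|\le 1$, $y_{mi}\in\{-1,1\}$. The data are linearly separable: some $w$ satisfies $y_{mi}\langle w,x_{mi}\rangle>0$ for all $m,i$. Let $$\gamma=\max_{\|w\|=1}\min_{m,i}y_{mi}\langle w,x_{mi}\rangle,\qquad F_m(w)=\frac1n\sum_{i=1}^n\log\bigl(1+e^{-y_{mi}\langle w,x_{mi}\rangle}\bigr),\qquad F=\frac1M\sum_{m=1}^M F_m .$$ Local GD from $w_0$ with $R$ rounds, $K\ge1$ local steps, step size $\eta$ and weights $\alpha_{r,k}$ sets $\bar w_0=w_0$; in round $r$ each client starts from $w^m_{r,0}=\bar w_r$ and performs $w^m_{r,k+1}=w^m_{r,k}-\eta\nabla F_m(w^m_{r,k})$ for $k<K$, then $\bar w_{r+1}=\frac1M\sum_m w^m_{r,K}$; it returns $\sum_{r<R}\sum_{k<K}\alpha_{r,k}\frac1M\sum_m w^m_{r,k}$. Two-Stage Local GD with $R$ rounds first runs Local GD from $0$ for $r_0$ rounds with step size $\eta_1$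 and weights $\alpha_{r,k}\propto\beta^{Kr+k}$, $\beta=1-\frac1{Kr_0}$ (normalized to sum one). Then, starting from the output of that stage, it runs Local GD for $R-r_0$ rounds with step size $\eta_2$, and returns as $\hat w_2$ the global model $\bar w_{R-r_0-1}$ at the start of the last round of the second stage. Write $$X=\frac{KM}{\gamma^4}+\frac{(KM)^{3/4}}{\gamma^{5/2}},\qquad S=\min\Bigl\{\frac1K,\frac{M^{1/3}}{\gamma^2K^{2/3}}\Bigr\},\qquad L=\log\Bigl(e+\frac{KM}{\gamma}\Bigr).$$ **Statement.** Let $\eta_2=1$, $\eta_1=\tilde\Theta(S)$ with a small enough upper constant and $r_0=\tilde\Theta(X)$ with a large enough lower constant and logarithmic power. Then $F(\hat w_2)\le\epsilon$ as long as $R\ge\tilde\Omega\bigl(X+\frac1{\gamma^2K\epsilon}\bigr)$; if moreover $K=\Theta(\gamma/\sqrt{M\epsilon})$, then $F(\hat w_2)\le\epsilon$ as long as $R\ge\tilde\Omega\bigl(\frac{M^{1/2}}{\gamma^3\epsilon^{1/2}}+\frac1{\gamma^{7/4}\epsilon^{3/8}}\bigr)$. Precisely: there is a universal $c>0$ such that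 for all $c'>0$, $q\in\mathbb N$ there are $C_0>0$, $p_0\in\mathbb N$ such that for all $C_1>0$, $p_1\in\mathbb N$, $a,b>0$ there are $C>0$, $p\in\mathbb N$ such that, for all $d,M,n$, all data as above, all $K\ge1$, $\epsilon>0$, all real $\eta_1$ with $c'S/L^q\le\eta_1\le cS$, all natural $r_0$ with $C_0XL^{p_0}\le r_0\le C_1XL^{p_1}$, and all natural $R$, the output $\hat w_2$ of Two-Stage Local GD with $\eta_2=1$ satisfies: 1. if $$R\ge C\,\log^p\!\Bigl(e+\frac{KM}{\gamma}+\frac1\epsilon\Bigr)\Bigl(\frac{KM}{\gamma^4}+\frac{(KM)^{3/4}}{\gamma^{5/2}}+\frac1{\gamma^2K\epsilon}\Bigr),$$ then $F(\hat w_2)\le\epsilon$; 2. if $\dfrac{a\gamma}{\sqrt{M\epsilon}}\le K\le \dfrac{b\gamma}{\sqrt{M\epsilon}}$ and $$R\ge C\,\log^p\!\Bigl(e+\frac M\epsilon\Bigr)\Bigl(\frac{M^{1/2}}{\gamma^3\epsilon^{1/2}}+\frac1{\gamma^{7/4}\epsilon^{3/8}}\Bigr),$$ then $F(\hat w_2)\le\epsilon$.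 -/

import Mathlib

noncomputable section

namespace TwoStageLocalGD

/-- The input space `ℝ^d` with its Euclidean norm. -/
abbrev Vec (d : ℕ) : Type := EuclideanSpace ℝ (Fin d)

/-- The logistic loss `ℓ(z) = log (1 + exp (-z))`. -/
def logisticLoss (z : ℝ) : ℝ := Real.log (1 + Real.exp (-z))

/-- Local datasets of `M` clients with `n` labelled samples each: `x m i ∈ ℝ^d` is the `i`-th
input of client `m`, and `y m i ∈ {-1, 1}` is its label. -/
structure ClientData (d M n : ℕ) where
  x : Fin M → Fin n → Vec d
  y : Fin M → Fin n → ℝ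
  label : ∀ m i, y m i = 1 ∨ y m i = -1

namespace ClientData

variable {d M n : ℕ} (D : ClientData d M n)

/-- Linear separability: a single `w` classifies the data of all clients correctly. -/
def Separable : Prop := ∃ w : Vec d, ∀ m i, 0 < D.y m i * inner ℝ w (D.x m i)

/-- The maximum margin `γ = max_{‖w‖ = 1} min_{m, i} y_{mi} ⟨w, x_{mi}⟩` of the combined data. -/
def margin : ℝ :=
  ⨆ w : Metric.sphere (0 : Vec d) 1, ⨅ s : Fin M × Fin n,
    D.y s.1 s.2 * inner ℝ (w : Vec d) (D.x s.1 s.2)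

/-- The local objective `F_m` of client `m`. -/
def localObjective (m : Fin M) (w : Vec d) : ℝ :=
  (1 / (n : ℝ)) * ∑ i, logisticLoss (D.y m i * inner ℝ w (D.x m i))

/-- The global objective `F`, the average of the local objectives. -/
def objective (w : Vec d) : ℝ := (1 / (M : ℝ)) * ∑ m, D.localObjective m w

/-- One gradient step of client `m`. -/
def localStep (η : ℝ) (m : Fin M) (w : Vec d) : Vec d :=
  w - η • gradient (D.localObjective m) w

/-- The average over the clients of their local models after `k` local gradient steps, all
clients having started from `w`. -/
def averageAfter (η : ℝ) (k : ℕ) (w : Vec d) : Vec d :=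
  (1 / (M : ℝ)) • ∑ m, (D.localStep η m)^[k] w

/-- The global model at the start of round `r` of Local GD with `K` local steps per round. -/
def globalModel (w₀ : Vec d) (K : ℕ) (η : ℝ) (r : ℕ) : Vec d :=
  (D.averageAfter η K)^[r] w₀

/-- Local GD with `R` rounds; it returns the combination with weights `α r k` of the averaged
local models. -/
def localGD (w₀ : Vec d) (R K : ℕ) (η : ℝ) (α : ℕ → ℕ → ℝ) : Vec d :=
  ∑ r ∈ Finset.range R, ∑ k ∈ Finset.range K,
    α r k • D.averageAfter η k (D.globalModel w₀ K η r)

/-- The weights that select the global model at the start of the last of `R` rounds. -/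
def lastRoundWeights (R r k : ℕ) : ℝ := if r + 1 = R ∧ k = 0 then 1 else 0

/-- Two-Stage Local GD with `R` rounds in total: `r₀` rounds of Local GD with step size `η₁` and
weights `α`, then, from the output of the first stage, `R - r₀` rounds with step size `η₂`, of
which the last global model is returned. -/
def twoStageLocalGD (w₀ : Vec d) (R K : ℕ) (η₁ η₂ : ℝ) (α : ℕ → ℕ → ℝ) (r₀ : ℕ) : Vec d :=
  D.localGD (D.localGD w₀ r₀ K η₁ α) (R - r₀) K η₂ (lastRoundWeights (R - r₀))

end ClientData

/-- The averaging weights of the first stage, run for `r₀` rounds of `K` steps: proportional to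
`β ^ t` at the absolute time `t = K r + k`, where `β = 1 - 1 / (K r₀)`, and normalized to have
sum one. -/
def warmupWeights (K r₀ r k : ℕ) : ℝ :=
  (1 - 1 / ((K : ℝ) * r₀)) ^ (K * r + k) /
    ∑ t ∈ Finset.range (K * r₀), (1 - 1 / ((K : ℝ) * r₀)) ^ t

/-- The scale `K M / γ ^ 4 + (K M) ^ (3/4) / γ ^ (5/2)` of the length of the first stage. -/
def warmupScale (K M : ℕ) (γ : ℝ) : ℝ :=
  (K : ℝ) * M / γ ^ 4 + ((K : ℝ) * M) ^ (3 / 4 : ℝ) / γ ^ (5 / 2 : ℝ)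

/-- The scale `min {1 / K, M ^ (1/3) / (γ ^ 2 K ^ (2/3))}` of the first step size (with second
step size one). -/
def stepScale (K M : ℕ) (γ : ℝ) : ℝ :=
  min (1 / (K : ℝ)) ((M : ℝ) ^ (1 / 3 : ℝ) / (γ ^ 2 * (K : ℝ) ^ (2 / 3 : ℝ)))

/-- The logarithmic factor `log (e + z)`, which is at least one for `z ≥ 0`. -/
def logFactor (z : ℝ) : ℝ := Real.log (Real.exp 1 + z)

end TwoStageLocalGD

end

/-! The logistic loss `ℓ` is self-bounding: `|ℓ'| ≤ min(1, ℓ)`, and shifting the argument by `ρ`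
changes `ℓ` and `|ℓ'|` by a factor at most `exp ρ`. Data in the unit ball carry this over to the
`F_m` and `F`.

Regret. For `η ≤ 1`, `‖∇F_m‖² ≤ F_m` and convexity make each local step satisfy `‖w⁺ - u‖² ≤ ‖w -
u‖² - η F_m(w) + 2η F_m(u)`. Averaging over clients does not increase the mean squared distance to
`u`, so this telescopes over steps and rounds without any term for client drift
(`norm_globalModel_sub_sq_le`). The comparators are `u = (2/γ) log A • v`, with `v` a unit vector of
margin at least `γ/2`, so `F(u) ≤ 1/A`.

First stage. Since `γ ≤ 1`, the step scale is exactly `1/K`. With `ηK ≤ 1` no client moves by more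
than one in a round, so losses at averaged and at local models agree up to `exp 2`. The weights are
at most twice uniform, and Jensen's inequality gives `F ≲ ‖u‖²/(ηKr₀) + F(u)`. A length `r₀` of
order `KM/γ³`, up to logarithms, brings `F` below the threshold `γ/(32KM)`; the scale `KM/γ⁴`
exceeds this.

Second stage. Below the threshold each client moves little in a round, even with unit steps, so a
round is `K` gradient steps on `F` up to an error of order `K²M G²`, where `G` is the mean slope.
Separability gives `‖∇F‖ ≥ (γ/2) G`, so the error is a fraction of `K‖∇F‖` and `F` does not increase
(`objective_averageAfter_one_le`). Monotonicity turns the regret bound into one for the last model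
(`objective_globalModel_one_le`). The first stage ends within `log/γ` of the comparators, which
yields the rate `1/(γ²Kε)`. The tuned case substitutes `K` into the general one (`tuned_rounds_le`).
-/

namespace TwoStageLocalGD

/-! ### The logistic loss and its slope -/

/-- The absolute value `1 / (1 + exp z)` of the derivative of the logistic loss. -/
noncomputable def lossSlope (z : ℝ) : ℝ := 1 / (1 + Real.exp z)

lemma lossSlope_nonneg (z : ℝ) : 0 ≤ lossSlope z := by
  unfold lossSlope; positivity

lemma lossSlope_le_one (z : ℝ) : lossSlope z ≤ 1 := by
  unfold lossSlope
  rw [div_le_one (by positivity)]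
  linarith [Real.exp_pos z]

lemma logisticLoss_le_exp_neg (z : ℝ) : logisticLoss z ≤ Real.exp (-z) := by
  unfold logisticLoss
  have := Real.log_le_sub_one_of_pos (show 0 < 1 + Real.exp (-z) by positivity)
  linarith

lemma lossSlope_eq (z : ℝ) : lossSlope z = Real.exp (-z) / (1 + Real.exp (-z)) := by
  unfold lossSlope
  have h : Real.exp (-z) * Real.exp z = 1 := by rw [← Real.exp_add]; simp
  rw [div_eq_div_iff (by positivity) (by positivity)]
  linarith

lemma one_sub_lossSlope (z : ℝ) : 1 - lossSlope z = 1 / (1 + Real.exp (-z)) := by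
  rw [lossSlope_eq]
  have : (1 + Real.exp (-z)) ≠ 0 := by positivity
  field_simp
  ring

/-- This is `1 - 1/t ≤ log t` at `t = 1 + exp (-z)`; it lets gradients be paid for by losses. -/
lemma lossSlope_le_logisticLoss (z : ℝ) : lossSlope z ≤ logisticLoss z := by
  have h := Real.one_sub_inv_le_log_of_pos (show 0 < 1 + Real.exp (-z) by positivity)
  have h' := one_sub_lossSlope z
  rw [one_div] at h'
  unfold logisticLoss
  linarith

lemma logisticLoss_nonneg (z : ℝ) : 0 ≤ logisticLoss z :=
  (lossSlope_nonneg z).trans (lossSlope_le_logisticLoss z)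

lemma hasDerivAt_logisticLoss (z : ℝ) : HasDerivAt logisticLoss (-lossSlope z) z := by
  have h : HasDerivAt (fun z : ℝ => 1 + Real.exp (-z)) (Real.exp (-z) * (-1)) z :=
    ((hasDerivAt_neg z).exp).const_add 1
  have := h.log (by positivity)
  exact this.congr_deriv (by rw [lossSlope_eq]; ring)

/-- The logistic loss lies above its tangents. -/
lemma logisticLoss_tangent_le (a b : ℝ) :
    logisticLoss a - lossSlope a * (b - a) ≤ logisticLoss b := by
  -- Convexity of `exp` between `0` and `a - b`, with weights `1 - lossSlope a` and `lossSlope a`;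
  -- the logarithm of the result is the tangent inequality.
  have hc := convexOn_exp.2 (Set.mem_univ (0 : ℝ)) (Set.mem_univ (a - b))
    (sub_nonneg.2 (lossSlope_le_one a)) (lossSlope_nonneg a) (by ring)
  simp only [smul_eq_mul, mul_zero, zero_add, Real.exp_zero, mul_one] at hc
  have hratio : (1 - lossSlope a) + lossSlope a * Real.exp (a - b) =
      (1 + Real.exp (-b)) / (1 + Real.exp (-a)) := by
    rw [one_sub_lossSlope, lossSlope_eq, show a - b = a + -b by ring, Real.exp_add]
    have h : Real.exp (-a) * Real.exp a = 1 := by rw [← Real.exp_add]; simp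
    have h' : (1 + Real.exp (-a)) ≠ 0 := by positivity
    field_simp
    linear_combination Real.exp (-b) * h
  rw [hratio] at hc
  have hl := (Real.le_log_iff_exp_le (by positivity)).2 hc
  rw [Real.log_div (by positivity) (by positivity)] at hl
  unfold logisticLoss
  linarith

/-- Bernoulli's inequality `1 + cs ≤ (1 + s)^c` with `c = exp ρ`, `s = exp (-b)`, then logarithms.
-/
lemma logisticLoss_le_exp_mul {a b ρ : ℝ} (h : |a - b| ≤ ρ) :
    logisticLoss a ≤ Real.exp ρ * logisticLoss b := by
  have h0 : 0 ≤ ρ := (abs_nonneg _).trans h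
  have h1 : Real.exp (-a) ≤ Real.exp ρ * Real.exp (-b) := by
    rw [← Real.exp_add]
    exact Real.exp_le_exp.2 (by linarith [(abs_le.1 h).1])
  have h2 := one_add_mul_self_le_rpow_one_add (s := Real.exp (-b))
    (by linarith [Real.exp_pos (-b)]) (Real.one_le_exp h0)
  unfold logisticLoss
  rw [← Real.log_rpow (by positivity)]
  exact Real.log_le_log (by positivity) (by linarith)

lemma lossSlope_le_exp_mul {a b ρ : ℝ} (h : |a - b| ≤ ρ) :
    lossSlope a ≤ Real.exp ρ * lossSlope b := by
  have h0 : 0 ≤ ρ := (abs_nonneg _).trans h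
  have h1 : Real.exp b ≤ Real.exp ρ * Real.exp a := by
    rw [← Real.exp_add]
    exact Real.exp_le_exp.2 (by linarith [(abs_le.1 h).1])
  unfold lossSlope
  rw [mul_one_div, div_le_div_iff₀ (by positivity) (by positivity)]
  linarith [Real.one_le_exp h0]

lemma abs_lossSlope_sub_le {a b ρ : ℝ} (h : |a - b| ≤ ρ) :
    |lossSlope a - lossSlope b| ≤ (Real.exp ρ - 1) * lossSlope b := by
  have h0 : 0 ≤ ρ := (abs_nonneg _).trans h
  have h1 := lossSlope_le_exp_mul h
  have h2 := lossSlope_le_exp_mul (by rwa [abs_sub_comm] at h : |b - a| ≤ ρ)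
  have he := Real.one_le_exp h0
  have hs := lossSlope_nonneg a
  rw [abs_le]
  constructor
  · by_cases hab : lossSlope a ≤ lossSlope b
    -- Here `lossSlope b - lossSlope a ≤ (exp ρ - 1) * lossSlope a`, and the slope at `a` is the
    -- smaller one.
    · nlinarith
    · nlinarith [lossSlope_nonneg b]
  · linarith

/-! ### Local objectives, their gradients, and one local step -/

namespace ClientData

variable {d M n : ℕ} (D : ClientData d M n)

/-- The mean slope of the loss over the data of client `m`. -/
noncomputable def localSlope (m : Fin M) (w : Vec d) : ℝ :=
  (1 / (n : ℝ)) * ∑ i, lossSlope (D.y m i * inner ℝ w (D.x m i))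

/-- The gradient of the local objective of client `m`, in closed form. -/
noncomputable def localGradient (m : Fin M) (w : Vec d) : Vec d :=
  (1 / (n : ℝ)) • ∑ i, (-lossSlope (D.y m i * inner ℝ w (D.x m i)) * D.y m i) • D.x m i

lemma abs_label (m : Fin M) (i : Fin n) : |D.y m i| = 1 := by
  rcases D.label m i with h | h <;> simp [h]

lemma gradient_localObjective (m : Fin M) (w : Vec d) :
    gradient (D.localObjective m) w = D.localGradient m w := by
  apply HasGradientAt.gradient
  rw [hasGradientAt_iff_hasFDerivAt]
  have hi : ∀ i, HasFDerivAt (fun w : Vec d => logisticLoss (D.y m i * inner ℝ w (D.x m i)))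
      (-lossSlope (D.y m i * inner ℝ w (D.x m i)) •
        (D.y m i • innerSL ℝ (D.x m i))) w := by
    intro i
    have h1 : HasFDerivAt (fun w : Vec d => D.y m i * inner ℝ w (D.x m i))
        (D.y m i • innerSL ℝ (D.x m i)) w := by
      have : (fun w : Vec d => D.y m i * inner ℝ w (D.x m i)) =
          fun w => (D.y m i • innerSL ℝ (D.x m i)) w := by
        ext v
        simp [real_inner_comm]
      rw [this]
      exact ContinuousLinearMap.hasFDerivAt _
    exact (hasDerivAt_logisticLoss _).comp_hasFDerivAt w h1
  have hs := (HasFDerivAt.fun_sum (u := Finset.univ) fun i _ => hi i).const_mul (1 / (n : ℝ))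
  refine HasFDerivAt.congr_fderiv hs ?_
  ext v
  simp only [localGradient, map_smul, map_sum, InnerProductSpace.toDual_apply_apply,
    smul_apply, sum_apply, innerSL_apply_apply, smul_eq_mul,
    neg_mul, mul_assoc]

variable {D}

lemma abs_margin_sub_le (hx : ∀ m i, ‖D.x m i‖ ≤ 1) (m : Fin M) (i : Fin n) (v w : Vec d) :
    |D.y m i * inner ℝ v (D.x m i) - D.y m i * inner ℝ w (D.x m i)| ≤ ‖v - w‖ := by
  rw [← mul_sub, ← inner_sub_left, abs_mul, D.abs_label, one_mul]
  refine (abs_real_inner_le_norm _ _).trans ?_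
  exact mul_le_of_le_one_right (norm_nonneg _) (hx m i)

lemma localSlope_nonneg (m : Fin M) (w : Vec d) : 0 ≤ D.localSlope m w :=
  mul_nonneg (by positivity) (Finset.sum_nonneg fun _ _ => lossSlope_nonneg _)

lemma localObjective_nonneg (m : Fin M) (w : Vec d) : 0 ≤ D.localObjective m w :=
  mul_nonneg (by positivity) (Finset.sum_nonneg fun _ _ => logisticLoss_nonneg _)

lemma localSlope_le_localObjective (m : Fin M) (w : Vec d) :
    D.localSlope m w ≤ D.localObjective m w :=
  mul_le_mul_of_nonneg_left (Finset.sum_le_sum fun _ _ => lossSlope_le_logisticLoss _)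
    (by positivity)

lemma mean_le_of_forall_le {N : ℕ} {f : Fin N → ℝ} {c : ℝ} (hc : 0 ≤ c) (h : ∀ i, f i ≤ c) :
    (1 / (N : ℝ)) * ∑ i, f i ≤ c := by
  rcases Nat.eq_zero_or_pos N with rfl | hN
  · simpa using hc
  · have : ∑ i, f i ≤ N * c := by
      simpa using Finset.sum_le_card_nsmul Finset.univ f c fun i _ => h i
    rw [one_div, inv_mul_le_iff₀ (by positivity)]
    exact this

lemma localSlope_le_one (m : Fin M) (w : Vec d) : D.localSlope m w ≤ 1 :=
  mean_le_of_forall_le zero_le_one fun _ => lossSlope_le_one _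

lemma norm_localGradient_le (hx : ∀ m i, ‖D.x m i‖ ≤ 1) (m : Fin M) (w : Vec d) :
    ‖D.localGradient m w‖ ≤ D.localSlope m w := by
  unfold localGradient localSlope
  rw [norm_smul, Real.norm_of_nonneg (by positivity)]
  refine mul_le_mul_of_nonneg_left ((norm_sum_le _ _).trans (Finset.sum_le_sum fun i _ => ?_))
    (by positivity)
  rw [norm_smul, Real.norm_eq_abs, abs_mul, abs_neg, D.abs_label, mul_one,
    abs_of_nonneg (lossSlope_nonneg _)]
  exact mul_le_of_le_one_right (lossSlope_nonneg _) (hx m i)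

/-- The change is relative to the slope at `w`. Hence drift is quadratic in the slopes, which is
what makes unit steps affordable at small loss. -/
lemma norm_localGradient_sub_le (hx : ∀ m i, ‖D.x m i‖ ≤ 1) (m : Fin M) (v w : Vec d) :
    ‖D.localGradient m v - D.localGradient m w‖ ≤
      (Real.exp ‖v - w‖ - 1) * D.localSlope m w := by
  unfold localGradient localSlope
  rw [← smul_sub, ← Finset.sum_sub_distrib, norm_smul, Real.norm_of_nonneg (by positivity),
    mul_left_comm, Finset.mul_sum]
  refine mul_le_mul_of_nonneg_left ((norm_sum_le _ _).trans (Finset.sum_le_sum fun i _ => ?_))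
    (by positivity)
  rw [← sub_smul, ← sub_mul, norm_smul, Real.norm_eq_abs, abs_mul, D.abs_label, mul_one,
    neg_sub_neg, abs_sub_comm]
  exact (mul_le_of_le_one_right (abs_nonneg _) (hx m i)).trans
    (abs_lossSlope_sub_le (abs_margin_sub_le hx m i v w))

lemma localObjective_le_exp_mul (hx : ∀ m i, ‖D.x m i‖ ≤ 1) (m : Fin M) (v w : Vec d) :
    D.localObjective m v ≤ Real.exp ‖v - w‖ * D.localObjective m w := by
  unfold localObjective
  rw [mul_left_comm, Finset.mul_sum _ _ (Real.exp _)]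
  exact mul_le_mul_of_nonneg_left (Finset.sum_le_sum fun i _ =>
    logisticLoss_le_exp_mul (abs_margin_sub_le hx m i v w)) (by positivity)

lemma localSlope_le_exp_mul (hx : ∀ m i, ‖D.x m i‖ ≤ 1) (m : Fin M) (v w : Vec d) :
    D.localSlope m v ≤ Real.exp ‖v - w‖ * D.localSlope m w := by
  unfold localSlope
  rw [mul_left_comm, Finset.mul_sum _ _ (Real.exp _)]
  exact mul_le_mul_of_nonneg_left (Finset.sum_le_sum fun i _ =>
    lossSlope_le_exp_mul (abs_margin_sub_le hx m i v w)) (by positivity)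

lemma inner_localGradient (m : Fin M) (w v : Vec d) :
    inner ℝ (D.localGradient m w) v = (1 / (n : ℝ)) * ∑ i,
      -lossSlope (D.y m i * inner ℝ w (D.x m i)) * (D.y m i * inner ℝ v (D.x m i)) := by
  unfold localGradient
  rw [real_inner_smul_left, sum_inner]
  congr 1
  refine Finset.sum_congr rfl fun i _ => ?_
  rw [real_inner_smul_left, real_inner_comm v, mul_assoc]

lemma localObjective_tangent_le (m : Fin M) (w u : Vec d) :
    D.localObjective m w + inner ℝ (D.localGradient m w) (u - w) ≤ D.localObjective m u := by
  unfold localObjective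
  rw [inner_localGradient, ← mul_add, ← Finset.sum_add_distrib]
  refine mul_le_mul_of_nonneg_left (Finset.sum_le_sum fun i _ => ?_) (by positivity)
  have := logisticLoss_tangent_le (D.y m i * inner ℝ w (D.x m i)) (D.y m i * inner ℝ u (D.x m i))
  rw [inner_sub_left]
  linarith

lemma localStep_eq (η : ℝ) (m : Fin M) (w : Vec d) :
    D.localStep η m w = w - η • D.localGradient m w := by
  rw [localStep, gradient_localObjective]

/-- Expanding the square, convexity yields `-2η F_m(w) + 2η F_m(u)`, and the quadratic term
`η²‖∇F_m(w)‖²` costs at most `η F_m(w)`, half of the gain. -/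
lemma norm_localStep_sub_sq_le (hx : ∀ m i, ‖D.x m i‖ ≤ 1) {η : ℝ} (h0 : 0 ≤ η) (h1 : η ≤ 1)
    (m : Fin M) (w u : Vec d) :
    ‖D.localStep η m w - u‖ ^ 2 ≤
      ‖w - u‖ ^ 2 - η * D.localObjective m w + 2 * η * D.localObjective m u := by
  rw [localStep_eq, sub_right_comm, norm_sub_sq_real, real_inner_smul_right, norm_smul,
    Real.norm_of_nonneg h0, real_inner_comm]
  have ht := localObjective_tangent_le (D := D) m w u
  rw [← neg_sub w u, inner_neg_right] at ht
  have hg := norm_localGradient_le hx m w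
  have hs := localSlope_le_one (D := D) m w
  have hF := localSlope_le_localObjective (D := D) m w
  have hg2 : ‖D.localGradient m w‖ ^ 2 ≤ D.localObjective m w := by
    nlinarith [norm_nonneg (D.localGradient m w)]
  have h3 : (η * ‖D.localGradient m w‖) ^ 2 ≤ η * D.localObjective m w := by
    rw [mul_pow]
    have := localObjective_nonneg (D := D) m w
    calc η ^ 2 * ‖D.localGradient m w‖ ^ 2 ≤ η ^ 2 * D.localObjective m w := by gcongr
      _ ≤ η * D.localObjective m w := by gcongr; nlinarith
  have h4 := mul_le_mul_of_nonneg_left ht h0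
  nlinarith

lemma norm_localStep_sub_le (hx : ∀ m i, ‖D.x m i‖ ≤ 1) {η : ℝ} (h0 : 0 ≤ η)
    (m : Fin M) (w v : Vec d) :
    ‖D.localStep η m w - v‖ ≤ ‖w - v‖ + η * D.localSlope m w := by
  rw [localStep_eq, sub_right_comm]
  refine (norm_sub_le _ _).trans ?_
  rw [norm_smul, Real.norm_of_nonneg h0]
  gcongr
  exact norm_localGradient_le hx m w

end ClientData

/-! ### Averages over clients and the global objective -/

namespace ClientData

variable {d M n : ℕ} {D : ClientData d M n}

lemma norm_mean_sub_sq_le (hM : 0 < M) (v : Fin M → Vec d) (u : Vec d) :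
    ‖(1 / (M : ℝ)) • ∑ m, v m - u‖ ^ 2 ≤ (1 / (M : ℝ)) * ∑ m, ‖v m - u‖ ^ 2 := by
  have hM' : (0 : ℝ) < M := by exact_mod_cast hM
  set c : Vec d := (1 / (M : ℝ)) • ∑ m, v m - u with hc
  have hsum : ∑ m, (v m - u) = (M : ℝ) • c := by
    rw [hc, smul_sub, smul_smul, mul_one_div_cancel hM'.ne', one_smul, Finset.sum_sub_distrib]
    simp [← Nat.cast_smul_eq_nsmul ℝ]
  -- The tangent of `‖·‖²` at the mean `c`; the linear terms average to `2‖c‖²`.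
  have h1 : ∀ m, 2 * inner ℝ (v m - u) c - ‖c‖ ^ 2 ≤ ‖v m - u‖ ^ 2 := by
    intro m
    have := norm_sub_sq_real (v m - u) c
    nlinarith [sq_nonneg ‖v m - u - c‖]
  have h2 := Finset.sum_le_sum fun m (_ : m ∈ Finset.univ) => h1 m
  rw [Finset.sum_sub_distrib, ← Finset.mul_sum, ← sum_inner, hsum, real_inner_smul_left,
    real_inner_self_eq_norm_sq] at h2
  simp only [Finset.sum_const, Finset.card_univ, Fintype.card_fin, nsmul_eq_mul] at h2
  rw [one_div, ← div_eq_inv_mul, le_div_iff₀ hM']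
  linarith

lemma norm_mean_sub_le (hM : 0 < M) (v : Fin M → Vec d) (u : Vec d) :
    ‖(1 / (M : ℝ)) • ∑ m, v m - u‖ ≤ (1 / (M : ℝ)) * ∑ m, ‖v m - u‖ := by
  have hM' : (0 : ℝ) < M := by exact_mod_cast hM
  have : (1 / (M : ℝ)) • ∑ m, v m - u = (1 / (M : ℝ)) • ∑ m, (v m - u) := by
    rw [Finset.sum_sub_distrib, smul_sub]
    simp [← Nat.cast_smul_eq_nsmul ℝ, smul_smul, hM'.ne']
  rw [this, norm_smul, Real.norm_of_nonneg (by positivity)]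
  gcongr
  exact norm_sum_le _ _

lemma objective_nonneg (w : Vec d) : 0 ≤ D.objective w :=
  mul_nonneg (by positivity) (Finset.sum_nonneg fun _ _ => localObjective_nonneg _ _)

/-- The mean slope of the loss over the data of all clients. -/
noncomputable def meanSlope (D : ClientData d M n) (w : Vec d) : ℝ :=
  (1 / (M : ℝ)) * ∑ m, D.localSlope m w

/-- The gradient of the global objective, in closed form. -/
noncomputable def meanGradient (D : ClientData d M n) (w : Vec d) : Vec d :=
  (1 / (M : ℝ)) • ∑ m, D.localGradient m w

lemma meanSlope_nonneg (w : Vec d) : 0 ≤ D.meanSlope w :=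
  mul_nonneg (by positivity) (Finset.sum_nonneg fun _ _ => localSlope_nonneg _ _)

lemma meanSlope_le_objective (w : Vec d) : D.meanSlope w ≤ D.objective w :=
  mul_le_mul_of_nonneg_left (Finset.sum_le_sum fun _ _ => localSlope_le_localObjective _ _)
    (by positivity)

/-- Bounding one client by the sum costs a factor `M`, the source of the `M` in the loss threshold.
-/
lemma le_card_mul_mean {f : Fin M → ℝ} (hf : ∀ m, 0 ≤ f m) (m : Fin M) :
    f m ≤ M * ((1 / (M : ℝ)) * ∑ m, f m) := by
  have hM' : (0 : ℝ) < M := by exact_mod_cast m.pos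
  rw [← mul_assoc, mul_one_div_cancel hM'.ne', one_mul]
  exact Finset.single_le_sum (f := f) (fun i _ => hf i) (Finset.mem_univ m)

lemma objective_tangent_le (w u : Vec d) :
    D.objective w + inner ℝ (D.meanGradient w) (u - w) ≤ D.objective u := by
  unfold objective meanGradient
  rw [real_inner_smul_left, sum_inner, ← mul_add, ← Finset.sum_add_distrib]
  exact mul_le_mul_of_nonneg_left (Finset.sum_le_sum fun m _ => localObjective_tangent_le m w u)
    (by positivity)

/-- Jensen's inequality for the global objective. -/
lemma objective_sum_smul_le {ι : Type*} (s : Finset ι) (a : ι → ℝ) (v : ι → Vec d)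
    (ha : ∀ i ∈ s, 0 ≤ a i) (h1 : ∑ i ∈ s, a i = 1) :
    D.objective (∑ i ∈ s, a i • v i) ≤ ∑ i ∈ s, a i * D.objective (v i) := by
  set p := ∑ i ∈ s, a i • v i with hp
  have h := Finset.sum_le_sum fun i (hi : i ∈ s) =>
    mul_le_mul_of_nonneg_left (objective_tangent_le (D := D) p (v i)) (ha i hi)
  have h0 : ∑ i ∈ s, a i * inner ℝ (D.meanGradient p) (v i - p) = 0 := by
    simp_rw [← real_inner_smul_right, ← inner_sum, smul_sub, Finset.sum_sub_distrib,
      ← Finset.sum_smul, h1, one_smul, ← hp, sub_self, inner_zero_right]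
  simp_rw [mul_add, Finset.sum_add_distrib] at h
  rw [h0, ← Finset.sum_mul, h1] at h
  linarith

lemma norm_sum_smul_sub_le {ι : Type*} (s : Finset ι) (a : ι → ℝ) (v : ι → Vec d) (u : Vec d)
    {ρ : ℝ} (ha : ∀ i ∈ s, 0 ≤ a i) (h1 : ∑ i ∈ s, a i = 1) (hv : ∀ i ∈ s, ‖v i - u‖ ≤ ρ) :
    ‖∑ i ∈ s, a i • v i - u‖ ≤ ρ := by
  have : ∑ i ∈ s, a i • v i - u = ∑ i ∈ s, a i • (v i - u) := by
    simp_rw [smul_sub, Finset.sum_sub_distrib, ← Finset.sum_smul, h1, one_smul]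
  rw [this]
  refine (norm_sum_le _ _).trans ?_
  calc ∑ i ∈ s, ‖a i • (v i - u)‖ ≤ ∑ i ∈ s, a i * ρ := by
        refine Finset.sum_le_sum fun i hi => ?_
        rw [norm_smul, Real.norm_of_nonneg (ha i hi)]
        exact mul_le_mul_of_nonneg_left (hv i hi) (ha i hi)
    _ = ρ := by rw [← Finset.sum_mul, h1, one_mul]

lemma objective_smul_le {v : Vec d} {μ t : ℝ} (ht : 0 ≤ t)
    (hv : ∀ m i, μ ≤ D.y m i * inner ℝ v (D.x m i)) :
    D.objective (t • v) ≤ Real.exp (-(t * μ)) := by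
  refine mean_le_of_forall_le (by positivity) fun m => mean_le_of_forall_le (by positivity)
    fun i => (logisticLoss_le_exp_neg _).trans (Real.exp_le_exp.2 (neg_le_neg ?_))
  rw [real_inner_smul_left, mul_left_comm]
  exact mul_le_mul_of_nonneg_left (hv m i) ht

/-- The gradient of the global objective is bounded from below by the margin. -/
lemma mul_meanSlope_le_norm_meanGradient {v : Vec d} {μ : ℝ} (hv1 : ‖v‖ = 1)
    (hv : ∀ m i, μ ≤ D.y m i * inner ℝ v (D.x m i)) (w : Vec d) :
    μ * D.meanSlope w ≤ ‖D.meanGradient w‖ := by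
  have h1 : ∀ m, μ * D.localSlope m w ≤ -inner ℝ (D.localGradient m w) v := by
    intro m
    rw [inner_localGradient, localSlope, mul_left_comm, ← mul_neg, ← Finset.sum_neg_distrib,
      Finset.mul_sum _ _ μ]
    refine mul_le_mul_of_nonneg_left (Finset.sum_le_sum fun i _ => ?_) (by positivity)
    nlinarith [hv m i, lossSlope_nonneg (D.y m i * inner ℝ w (D.x m i))]
  have h2 : μ * D.meanSlope w ≤ -inner ℝ (D.meanGradient w) v := by
    rw [meanSlope, meanGradient, real_inner_smul_left, sum_inner, mul_left_comm, ← mul_neg,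
      ← Finset.sum_neg_distrib, Finset.mul_sum _ _ μ]
    exact mul_le_mul_of_nonneg_left (Finset.sum_le_sum fun m _ => h1 m) (by positivity)
  have h3 := abs_real_inner_le_norm (D.meanGradient w) v
  rw [hv1, mul_one] at h3
  linarith [neg_le_abs (inner ℝ (D.meanGradient w) v)]

lemma norm_meanGradient_sub_le (hx : ∀ m i, ‖D.x m i‖ ≤ 1) (v w : Vec d) :
    ‖D.meanGradient v - D.meanGradient w‖ ≤ (Real.exp ‖v - w‖ - 1) * D.meanSlope w := by
  unfold meanGradient meanSlope
  rw [← smul_sub, ← Finset.sum_sub_distrib, norm_smul, Real.norm_of_nonneg (by positivity),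
    mul_left_comm, Finset.mul_sum]
  exact mul_le_mul_of_nonneg_left ((norm_sum_le _ _).trans
    (Finset.sum_le_sum fun m _ => norm_localGradient_sub_le hx m v w)) (by positivity)

/-! ### Regret over rounds -/

/-- The sum over the `K` local steps of a round that starts from `w` of the mean over the clients
of their local losses at their local models. -/
noncomputable def roundLoss (D : ClientData d M n) (η : ℝ) (K : ℕ) (w : Vec d) : ℝ :=
  ∑ k ∈ Finset.range K, (1 / (M : ℝ)) * ∑ m, D.localObjective m ((D.localStep η m)^[k] w)

lemma norm_iterate_localStep_sub_sq_le (hx : ∀ m i, ‖D.x m i‖ ≤ 1) {η : ℝ} (h0 : 0 ≤ η)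
    (h1 : η ≤ 1) (m : Fin M) (w u : Vec d) (k : ℕ) :
    ‖(D.localStep η m)^[k] w - u‖ ^ 2 +
        η * ∑ j ∈ Finset.range k, D.localObjective m ((D.localStep η m)^[j] w) ≤
      ‖w - u‖ ^ 2 + 2 * η * k * D.localObjective m u := by
  induction k with
  | zero => simp
  | succ k ih =>
    rw [Function.iterate_succ_apply', Finset.sum_range_succ]
    have := norm_localStep_sub_sq_le hx h0 h1 m ((D.localStep η m)^[k] w) u
    push_cast
    linarith

/-- Averaging the clients' bounds, Jensen's inequality for `‖· - u‖²` absorbs the communication step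
at no cost. -/
lemma norm_averageAfter_sub_sq_le (hx : ∀ m i, ‖D.x m i‖ ≤ 1) (hM : 0 < M) {η : ℝ} (h0 : 0 ≤ η)
    (h1 : η ≤ 1) (w u : Vec d) (k : ℕ) :
    ‖D.averageAfter η k w - u‖ ^ 2 + η * D.roundLoss η k w ≤
      ‖w - u‖ ^ 2 + 2 * η * k * D.objective u := by
  have hM' : (0 : ℝ) < M := by exact_mod_cast hM
  have hj := norm_mean_sub_sq_le hM (fun m => (D.localStep η m)^[k] w) u
  have hs := mul_le_mul_of_nonneg_left (Finset.sum_le_sum fun m (_ : m ∈ Finset.univ) =>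
    norm_iterate_localStep_sub_sq_le hx h0 h1 m w u k) (show 0 ≤ 1 / (M : ℝ) by positivity)
  simp_rw [Finset.sum_add_distrib, ← Finset.mul_sum, mul_add] at hs
  rw [Finset.sum_comm] at hs
  have hc : (1 / (M : ℝ)) * ∑ _m : Fin M, ‖w - u‖ ^ 2 = ‖w - u‖ ^ 2 := by
    simp [hM'.ne']
  rw [hc] at hs
  unfold averageAfter roundLoss objective
  rw [← Finset.mul_sum]
  linarith

lemma norm_globalModel_sub_sq_le (hx : ∀ m i, ‖D.x m i‖ ≤ 1) (hM : 0 < M) {η : ℝ} (h0 : 0 ≤ η)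
    (h1 : η ≤ 1) (w u : Vec d) (K R : ℕ) :
    ‖D.globalModel w K η R - u‖ ^ 2 +
        η * ∑ r ∈ Finset.range R, D.roundLoss η K (D.globalModel w K η r) ≤
      ‖w - u‖ ^ 2 + 2 * η * (K * R) * D.objective u := by
  induction R with
  | zero => simp [globalModel]
  | succ R ih =>
    rw [Finset.sum_range_succ]
    have := norm_averageAfter_sub_sq_le hx hM h0 h1 (D.globalModel w K η R) u K
    rw [show D.globalModel w K η (R + 1) = D.averageAfter η K (D.globalModel w K η R) from
      Function.iterate_succ_apply' _ _ _]
    push_cast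
    linarith

lemma roundLoss_nonneg (η : ℝ) (K : ℕ) (w : Vec d) : 0 ≤ D.roundLoss η K w :=
  Finset.sum_nonneg fun _ _ => mul_nonneg (by positivity)
    (Finset.sum_nonneg fun _ _ => localObjective_nonneg _ _)

lemma norm_iterate_localStep_sub_le (hx : ∀ m i, ‖D.x m i‖ ≤ 1) {η : ℝ} (h0 : 0 ≤ η)
    (m : Fin M) (w : Vec d) (k : ℕ) : ‖(D.localStep η m)^[k] w - w‖ ≤ η * k := by
  induction k with
  | zero => simp
  | succ k ih =>
    rw [Function.iterate_succ_apply']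
    have h := norm_localStep_sub_le hx h0 m ((D.localStep η m)^[k] w) w
    have h' := mul_le_of_le_one_right h0
      (localSlope_le_one (D := D) m ((D.localStep η m)^[k] w))
    push_cast
    linarith

/-- When a round moves every local model by at most one, the averaged model has a loss comparable
to the losses of the clients at their local models. -/
lemma objective_averageAfter_le (hx : ∀ m i, ‖D.x m i‖ ≤ 1) (hM : 0 < M) {η : ℝ} (h0 : 0 ≤ η)
    (w : Vec d) {k : ℕ} (hk : η * k ≤ 1) :
    D.objective (D.averageAfter η k w) ≤
      Real.exp 2 * ((1 / (M : ℝ)) * ∑ m, D.localObjective m ((D.localStep η m)^[k] w)) := by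
  have hd : ∀ m, ‖(D.localStep η m)^[k] w - w‖ ≤ 1 := fun m =>
    (norm_iterate_localStep_sub_le hx h0 m w k).trans hk
  have ha : ‖D.averageAfter η k w - w‖ ≤ 1 :=
    (norm_mean_sub_le hM (fun m => (D.localStep η m)^[k] w) w).trans
      (mean_le_of_forall_le zero_le_one hd)
  unfold objective
  rw [mul_left_comm, Finset.mul_sum _ _ (Real.exp 2)]
  refine mul_le_mul_of_nonneg_left (Finset.sum_le_sum fun m _ => ?_) (by positivity)
  refine (localObjective_le_exp_mul hx m _ ((D.localStep η m)^[k] w)).trans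
    (mul_le_mul_of_nonneg_right (Real.exp_le_exp.2 ?_) (localObjective_nonneg _ _))
  have := norm_sub_le (D.averageAfter η k w - w) ((D.localStep η m)^[k] w - w)
  rw [sub_sub_sub_cancel_right] at this
  linarith [hd m]

end ClientData

/-! ### The geometric weights of the first stage -/

lemma sum_range_mul_add {α : Type*} [AddCommMonoid α] (f : ℕ → α) (K R : ℕ) :
    ∑ r ∈ Finset.range R, ∑ k ∈ Finset.range K, f (K * r + k) =
      ∑ t ∈ Finset.range (K * R), f t := by
  induction R with
  | zero => simp
  | succ R ih => rw [Finset.sum_range_succ, ih, mul_add, mul_one, Finset.sum_range_add]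

section Weights

variable {K r₀ : ℕ}

/-- The sum equals `N (1 - (1 - 1/N)^N)`, and `(1 - 1/N)^N ≤ exp (-1) ≤ 1/2`. -/
lemma half_le_sum_pow (N : ℕ) (hN : 0 < N) :
    (N : ℝ) / 2 ≤ ∑ t ∈ Finset.range N, (1 - 1 / (N : ℝ)) ^ t := by
  have hN' : (0 : ℝ) < N := by exact_mod_cast hN
  have hN1 : (1 : ℝ) ≤ N := by exact_mod_cast hN
  have h1 : 1 / (N : ℝ) ≤ 1 := by rw [div_le_one hN']; exact hN1
  have hpos : 0 < 1 / (N : ℝ) := by positivity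
  rw [geom_sum_eq (by linarith)]
  have h2 : (1 - 1 / (N : ℝ)) ^ N ≤ Real.exp (-1) := by
    calc (1 - 1 / (N : ℝ)) ^ N ≤ (Real.exp (-(1 / (N : ℝ)))) ^ N :=
          pow_le_pow_left₀ (by linarith) (Real.one_sub_le_exp_neg _) _
      _ = Real.exp (-1) := by
          rw [← Real.exp_nat_mul]
          congr 1
          field_simp
  have h3 : Real.exp (-1) ≤ 1 / 2 := by
    rw [Real.exp_neg, one_div]
    exact inv_anti₀ (by norm_num) (by linarith [Real.add_one_le_exp (1 : ℝ)])
  have h4 : ((1 - 1 / (N : ℝ)) ^ N - 1) / (1 - 1 / (N : ℝ) - 1) =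
      N * (1 - (1 - 1 / (N : ℝ)) ^ N) := by
    rw [show 1 - 1 / (N : ℝ) - 1 = -(1 / (N : ℝ)) by ring, div_neg, div_div_eq_mul_div]
    ring
  rw [h4]
  nlinarith

lemma one_sub_inv_nonneg (h : 0 < K * r₀) : 0 ≤ 1 - 1 / ((K : ℝ) * r₀) := by
  have h1 : (1 : ℝ) ≤ (K : ℝ) * r₀ := by exact_mod_cast h
  rw [sub_nonneg, div_le_one (by linarith)]
  exact h1

lemma warmupWeights_nonneg (h : 0 < K * r₀) (r k : ℕ) : 0 ≤ warmupWeights K r₀ r k := by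
  have := one_sub_inv_nonneg h
  exact div_nonneg (by positivity) (Finset.sum_nonneg fun _ _ => by positivity)

lemma warmupWeights_le (h : 0 < K * r₀) (r k : ℕ) :
    warmupWeights K r₀ r k ≤ 2 / ((K : ℝ) * r₀) := by
  have h0 := one_sub_inv_nonneg h
  have hs := half_le_sum_pow (K * r₀) h
  push_cast at hs
  have hN : (0 : ℝ) < (K : ℝ) * r₀ := by exact_mod_cast h
  unfold warmupWeights
  rw [div_le_div_iff₀ (by linarith) hN]
  have hp : (1 - 1 / ((K : ℝ) * r₀)) ^ (K * r + k) ≤ 1 :=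
    pow_le_one₀ h0 (by linarith [show 0 < 1 / ((K : ℝ) * r₀) by positivity])
  nlinarith

lemma sum_warmupWeights (h : 0 < K * r₀) :
    ∑ r ∈ Finset.range r₀, ∑ k ∈ Finset.range K, warmupWeights K r₀ r k = 1 := by
  have hs := half_le_sum_pow (K * r₀) h
  push_cast at hs
  have hN : (0 : ℝ) < (K : ℝ) * r₀ := by exact_mod_cast h
  unfold warmupWeights
  simp_rw [← Finset.sum_div]
  rw [sum_range_mul_add (fun t => (1 - 1 / ((K : ℝ) * r₀)) ^ t), div_self (by linarith)]

end Weights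

/-! ### The first stage -/

namespace ClientData

variable {d M n : ℕ} {D : ClientData d M n}

section Warmup

variable {K r₀ : ℕ} {η : ℝ}

lemma localGD_eq_sum_product (w : Vec d) (R K : ℕ) (η : ℝ) (α : ℕ → ℕ → ℝ) :
    D.localGD w R K η α = ∑ p ∈ Finset.range R ×ˢ Finset.range K,
      α p.1 p.2 • D.averageAfter η p.2 (D.globalModel w K η p.1) :=
  (Finset.sum_product' _ _ _).symm

/-- The loss after the first stage, relative to a comparator `u`. -/
lemma objective_localGD_warmupWeights_le (hx : ∀ m i, ‖D.x m i‖ ≤ 1) (hM : 0 < M)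
    (hK : 0 < K) (hr₀ : 0 < r₀) (h0 : 0 < η) (hηK : η * K ≤ 1) (u : Vec d) :
    D.objective (D.localGD 0 r₀ K η (warmupWeights K r₀)) ≤
      2 * Real.exp 2 * (‖u‖ ^ 2 / (η * (K * r₀)) + 2 * D.objective u) := by
  have hN : 0 < K * r₀ := Nat.mul_pos hK hr₀
  have hN' : (0 : ℝ) < (K : ℝ) * r₀ := by exact_mod_cast hN
  have hK1 : (1 : ℝ) ≤ K := by exact_mod_cast hK
  have h1 : η ≤ 1 := by nlinarith
  have hsum := sum_warmupWeights hN
  rw [← Finset.sum_product'] at hsum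
  rw [localGD_eq_sum_product]
  refine (objective_sum_smul_le _ (fun p : ℕ × ℕ => warmupWeights K r₀ p.1 p.2) _
    (fun p _ => warmupWeights_nonneg hN _ _) hsum).trans ?_
  have hloss : ∑ p ∈ Finset.range r₀ ×ˢ Finset.range K, warmupWeights K r₀ p.1 p.2 *
      D.objective (D.averageAfter η p.2 (D.globalModel 0 K η p.1)) ≤
      2 / ((K : ℝ) * r₀) * (Real.exp 2 *
        ∑ r ∈ Finset.range r₀, D.roundLoss η K (D.globalModel 0 K η r)) := by
    unfold roundLoss
    rw [← Finset.sum_product', Finset.mul_sum, Finset.mul_sum]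
    refine Finset.sum_le_sum fun p hp => ?_
    have hk : η * (p.2 : ℝ) ≤ 1 := by
      refine le_trans (mul_le_mul_of_nonneg_left ?_ h0.le) hηK
      exact_mod_cast (Finset.mem_range.1 (Finset.mem_product.1 hp).2).le
    exact mul_le_mul (warmupWeights_le hN _ _) (objective_averageAfter_le hx hM h0.le _ hk)
      (objective_nonneg _) (by positivity)
  refine hloss.trans ?_
  have hreg := norm_globalModel_sub_sq_le hx hM h0.le h1 0 u K r₀
  rw [zero_sub, norm_neg] at hreg
  have hS : ∑ r ∈ Finset.range r₀, D.roundLoss η K (D.globalModel 0 K η r) ≤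
      ‖u‖ ^ 2 / η + 2 * (K * r₀) * D.objective u := by
    rw [← mul_le_mul_iff_right₀ h0, mul_add, mul_div_cancel₀ _ h0.ne']
    linarith [sq_nonneg ‖D.globalModel 0 K η r₀ - u‖]
  calc 2 / ((K : ℝ) * r₀) * (Real.exp 2 *
        ∑ r ∈ Finset.range r₀, D.roundLoss η K (D.globalModel 0 K η r))
      ≤ 2 / ((K : ℝ) * r₀) * (Real.exp 2 * (‖u‖ ^ 2 / η + 2 * (K * r₀) * D.objective u)) := by
        gcongr
    _ = _ := by
        field_simp

/-- The first stage stays close to every comparator `u` with loss at most `1 / r₀`. -/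
lemma norm_localGD_warmupWeights_sub_le (hx : ∀ m i, ‖D.x m i‖ ≤ 1) (hM : 0 < M)
    (hK : 0 < K) (hr₀ : 0 < r₀) (h0 : 0 < η) (hηK : η * K ≤ 1) {u : Vec d}
    (hu : r₀ * D.objective u ≤ 1) :
    ‖D.localGD 0 r₀ K η (warmupWeights K r₀) - u‖ ≤ ‖u‖ + 2 := by
  have hN : 0 < K * r₀ := Nat.mul_pos hK hr₀
  have hK1 : (1 : ℝ) ≤ K := by exact_mod_cast hK
  have h1 : η ≤ 1 := by nlinarith
  have hsum := sum_warmupWeights hN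
  rw [← Finset.sum_product'] at hsum
  rw [localGD_eq_sum_product]
  refine norm_sum_smul_sub_le _ (fun p : ℕ × ℕ => warmupWeights K r₀ p.1 p.2) _ _
    (fun p _ => warmupWeights_nonneg hN _ _) hsum fun p hp => ?_
  have hr : (p.1 : ℝ) + 1 ≤ r₀ := by exact_mod_cast Finset.mem_range.1 (Finset.mem_product.1 hp).1
  have hk : (p.2 : ℝ) ≤ K := by
    exact_mod_cast (Finset.mem_range.1 (Finset.mem_product.1 hp).2).le
  have hF := objective_nonneg (D := D) u
  have hg := norm_globalModel_sub_sq_le hx hM h0.le h1 0 u K p.1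
  have ha := norm_averageAfter_sub_sq_le hx hM h0.le h1 (D.globalModel 0 K η p.1) u p.2
  have hs := mul_nonneg h0.le (Finset.sum_nonneg fun r (_ : r ∈ Finset.range p.1) =>
    roundLoss_nonneg (D := D) η K (D.globalModel 0 K η r))
  have hs' := mul_nonneg h0.le
    (roundLoss_nonneg (D := D) η p.2 (D.globalModel 0 K η p.1))
  rw [zero_sub, norm_neg] at hg
  -- The elapsed time is at most `r₀`, so the regret bound gives squared distance at most `‖u‖² + 2`
  -- for every averaged model.
  have hstep : η * (K * p.1) + η * p.2 ≤ r₀ := by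
    have h2 : η * (p.2 : ℝ) ≤ 1 := (mul_le_mul_of_nonneg_left hk h0.le).trans hηK
    have h3 : η * (K * p.1) ≤ p.1 := by
      rw [← mul_assoc]
      exact mul_le_of_le_one_left (Nat.cast_nonneg _) hηK
    linarith
  have hstepF := (mul_le_mul_of_nonneg_right hstep hF).trans hu
  refine abs_le_of_sq_le_sq' ?_ (by positivity) |>.2
  nlinarith [norm_nonneg u]

end Warmup

/-! ### The second stage: descent with unit steps -/

section Descent

variable {K : ℕ} {v : Vec d} {μ : ℝ}

/-- A client with a small slope at the start of a round moves little during the round. -/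
lemma norm_iterate_localStep_one_sub_le (hx : ∀ m i, ‖D.x m i‖ ≤ 1) (m : Fin M) (w : Vec d)
    {k : ℕ} (hk : 4 * k * D.localSlope m w ≤ 1) :
    ‖(D.localStep 1 m)^[k] w - w‖ ≤ 2 * k * D.localSlope m w := by
  have hG := localSlope_nonneg (D := D) m w
  induction k with
  | zero => simp
  | succ k ih =>
    push_cast at hk ⊢
    have ih' := ih (by nlinarith)
    rw [Function.iterate_succ_apply']
    have h := norm_localStep_sub_le hx zero_le_one m ((D.localStep 1 m)^[k] w) w
    have hs := localSlope_le_exp_mul hx m ((D.localStep 1 m)^[k] w) w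
    have he : Real.exp ‖(D.localStep 1 m)^[k] w - w‖ ≤ 2 := by
      -- The induction hypothesis bounds the displacement by `1/2`, where `exp t ≤ 1/(1 - t) ≤ 2`;
      -- each slope on the path is thus at most doubled.
      have hb : ‖(D.localStep 1 m)^[k] w - w‖ ≤ 1 / 2 := by nlinarith
      have := Real.exp_bound_div_one_sub_of_interval (norm_nonneg _)
        (show ‖(D.localStep 1 m)^[k] w - w‖ < 1 by linarith)
      refine this.trans ?_
      rw [div_le_iff₀ (by linarith)]
      linarith
    nlinarith

lemma exp_sub_one_le_two_mul {ρ t : ℝ} (h0 : 0 ≤ ρ) (h : ρ ≤ t) (ht : t ≤ 1) :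
    Real.exp ρ - 1 ≤ 2 * t := by
  have := Real.abs_exp_sub_one_le (x := ρ) (by rw [abs_of_nonneg h0]; linarith)
  rw [abs_of_nonneg h0] at this
  linarith [le_abs_self (Real.exp ρ - 1)]

lemma averageAfter_one_sub_eq (hM : 0 < M) (w : Vec d) (k : ℕ) :
    D.averageAfter 1 k w - w = -((1 / (M : ℝ)) • ∑ m, ∑ j ∈ Finset.range k,
      D.localGradient m ((D.localStep 1 m)^[j] w)) := by
  have hM' : (M : ℝ) ≠ 0 := by positivity
  have hit : ∀ m, (D.localStep 1 m)^[k] w = w - ∑ j ∈ Finset.range k,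
      D.localGradient m ((D.localStep 1 m)^[j] w) := by
    intro m
    induction k with
    | zero => simp
    | succ k ih =>
      rw [Function.iterate_succ_apply', localStep_eq, Finset.sum_range_succ, one_smul]
      nth_rw 1 [ih]
      abel
  unfold averageAfter
  simp_rw [hit, Finset.sum_sub_distrib, smul_sub]
  simp [← Nat.cast_smul_eq_nsmul ℝ, smul_smul, hM']

/-- A round with unit step size is close to `K` gradient steps on the global objective. -/
lemma norm_averageAfter_one_sub_add_le (hx : ∀ m i, ‖D.x m i‖ ≤ 1) (hM : 0 < M) (w : Vec d)
    (hw : ∀ m, 4 * K * D.localSlope m w ≤ 1) :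
    ‖D.averageAfter 1 K w - w + (K : ℝ) • D.meanGradient w‖ ≤
      4 * K ^ 2 * M * D.meanSlope w ^ 2 := by
  have heq : D.averageAfter 1 K w - w + (K : ℝ) • D.meanGradient w =
      -((1 / (M : ℝ)) • ∑ m, ∑ j ∈ Finset.range K,
        (D.localGradient m ((D.localStep 1 m)^[j] w) - D.localGradient m w)) := by
    rw [averageAfter_one_sub_eq hM, meanGradient]
    simp_rw [Finset.sum_sub_distrib, Finset.sum_const, Finset.card_range, smul_sub,
      ← Nat.cast_smul_eq_nsmul ℝ, ← Finset.smul_sum]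
    rw [smul_comm (K : ℝ)]
    abel
  have hj : ∀ m, ∀ j ∈ Finset.range K,
      ‖D.localGradient m ((D.localStep 1 m)^[j] w) - D.localGradient m w‖ ≤
        4 * K * M * D.meanSlope w * D.localSlope m w := by
    intro m j hj
    have hG := localSlope_nonneg (D := D) m w
    have hjK : (j : ℝ) ≤ K := by exact_mod_cast (Finset.mem_range.1 hj).le
    have hjG := mul_le_mul_of_nonneg_right hjK hG
    have hmove := norm_iterate_localStep_one_sub_le hx m w (k := j) (by linarith [hw m])
    have he := exp_sub_one_le_two_mul (norm_nonneg _)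
      (show ‖(D.localStep 1 m)^[j] w - w‖ ≤ 2 * (K * D.localSlope m w) by linarith)
      (by linarith [hw m])
    have hGM : D.localSlope m w ≤ M * D.meanSlope w :=
      le_card_mul_mean (fun m => localSlope_nonneg m w) m
    calc _ ≤ _ := norm_localGradient_sub_le hx m _ w
      _ ≤ 2 * (2 * (K * D.localSlope m w)) * D.localSlope m w := by gcongr
      _ ≤ 2 * (2 * (K * (M * D.meanSlope w))) * D.localSlope m w := by gcongr
      _ = _ := by ring
  rw [heq, norm_neg, norm_smul, Real.norm_of_nonneg (by positivity)]
  calc (1 / (M : ℝ)) * ‖∑ m, ∑ j ∈ Finset.range K,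
        (D.localGradient m ((D.localStep 1 m)^[j] w) - D.localGradient m w)‖
      ≤ (1 / (M : ℝ)) * ∑ m, ∑ j ∈ Finset.range K,
          4 * K * M * D.meanSlope w * D.localSlope m w := by
        gcongr
        exact (norm_sum_le _ _).trans (Finset.sum_le_sum fun m _ =>
          (norm_sum_le _ _).trans (Finset.sum_le_sum (hj m)))
    _ = (4 * K ^ 2 * M * D.meanSlope w) * ((1 / (M : ℝ)) * ∑ m, D.localSlope m w) := by
        simp_rw [Finset.sum_const, Finset.card_range, nsmul_eq_mul, ← Finset.mul_sum]
        ring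
    _ = _ := by
        rw [← meanSlope]
        ring

/-- Slope is at most loss, and a local loss is at most `M` times the mean loss. -/
lemma localSlope_le_of_objective_le (hK : 0 < K) (hμ1 : μ ≤ 1) {w : Vec d}
    (hw : 16 * K * M * D.objective w ≤ μ) (m : Fin M) : 16 * K * D.localSlope m w ≤ 1 := by
  have h1 : D.localObjective m w ≤ M * D.objective w :=
    le_card_mul_mean (fun m => localObjective_nonneg m w) m
  have h2 := (localSlope_le_localObjective (D := D) m w).trans h1
  have hK' : (0 : ℝ) < 16 * K := by positivity
  have := mul_le_mul_of_nonneg_left h2 hK'.le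
  linarith

/-- Below the loss threshold, a round with unit step size does not increase the loss. -/
lemma objective_averageAfter_one_le (hx : ∀ m i, ‖D.x m i‖ ≤ 1) (hM : 0 < M) (hK : 0 < K)
    (hv1 : ‖v‖ = 1) (hv : ∀ m i, μ ≤ D.y m i * inner ℝ v (D.x m i)) (hμ1 : μ ≤ 1)
    {w : Vec d} (hw : 16 * K * M * D.objective w ≤ μ) :
    D.objective (D.averageAfter 1 K w) ≤ D.objective w := by
  have hslope := localSlope_le_of_objective_le hK hμ1 hw
  have hslope0 : ∀ m, 0 ≤ (K : ℝ) * D.localSlope m w := fun m =>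
    mul_nonneg (Nat.cast_nonneg _) (localSlope_nonneg m w)
  have hM1 : (1 : ℝ) ≤ M := by exact_mod_cast hM
  have hK0 : (0 : ℝ) ≤ K := Nat.cast_nonneg _
  have hG := meanSlope_nonneg (D := D) w
  have hg := mul_meanSlope_le_norm_meanGradient hv1 hv w
  have hGF : 16 * K * M * D.meanSlope w ≤ μ :=
    (mul_le_mul_of_nonneg_left (meanSlope_le_objective w) (by positivity)).trans hw
  have hKG : (K : ℝ) * D.meanSlope w ≤ K * M * D.meanSlope w := by
    have : (K : ℝ) ≤ K * M := by nlinarith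
    exact mul_le_mul_of_nonneg_right this hG
  set g := D.meanGradient w
  set G := D.meanSlope w
  set w' := D.averageAfter 1 K w with hw'
  have hE1 := norm_averageAfter_one_sub_add_le hx hM w fun m => by
    linarith [hslope m, hslope0 m]
  -- The error `4K²MG²` is `(K/4)(16KMG) G ≤ (K/4) μG ≤ K‖g‖/4`, by the threshold and the margin
  -- bound on `‖g‖`.
  have hE1' : ‖w' - w + (K : ℝ) • g‖ ≤ K * ‖g‖ / 4 := by
    refine hE1.trans ?_
    have h1 : 16 * (K * M * G) * G ≤ μ * G := mul_le_mul_of_nonneg_right (by linarith) hG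
    have h2 := mul_le_mul_of_nonneg_left (h1.trans hg) hK0
    linarith
  have hmove : ‖w' - w‖ ≤ 2 * (K * G) := by
    refine (norm_mean_sub_le hM (fun m => (D.localStep 1 m)^[K] w) w).trans ?_
    rw [show 2 * (K * G) = (1 / (M : ℝ)) * ∑ m, 2 * K * D.localSlope m w by
      rw [← Finset.mul_sum]
      change 2 * (K * ((1 / (M : ℝ)) * ∑ m, D.localSlope m w)) = _
      ring]
    refine mul_le_mul_of_nonneg_left (Finset.sum_le_sum fun m _ => ?_) (by positivity)
    exact norm_iterate_localStep_one_sub_le hx m w (by linarith [hslope m, hslope0 m])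
  have hE2 : ‖D.meanGradient w' - g‖ ≤ ‖g‖ / 4 := by
    have he := exp_sub_one_le_two_mul (norm_nonneg _) hmove (by linarith)
    calc _ ≤ _ := norm_meanGradient_sub_le hx w' w
      _ ≤ 2 * (2 * (K * G)) * G := mul_le_mul_of_nonneg_right he hG
      _ ≤ μ * G / 4 := by
        have : 16 * (K * G) * G ≤ μ * G := mul_le_mul_of_nonneg_right (by linarith) hG
        linarith
      _ ≤ ‖g‖ / 4 := by linarith
  -- The tangent is taken at the new point, so it remains to see that `⟨∇F(w'), w - w'⟩ ≥ 0`; it is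
  -- at least `(1 - 1/4 - 5/16) K‖g‖²`.
  have ht := objective_tangent_le (D := D) w' w
  have hdecomp : inner ℝ (D.meanGradient w') (w - w') =
      K * ‖g‖ ^ 2 + K * inner ℝ (D.meanGradient w' - g) g -
        inner ℝ (D.meanGradient w') (w' - w + (K : ℝ) • g) := by
    rw [inner_add_right, real_inner_smul_right, inner_sub_left, real_inner_self_eq_norm_sq,
      ← neg_sub w' w, inner_neg_right]
    ring
  have hn : ‖D.meanGradient w'‖ ≤ 5 / 4 * ‖g‖ := by
    have := norm_add_le (D.meanGradient w' - g) g
    rw [sub_add_cancel] at this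
    linarith
  have hi1 : -(‖g‖ ^ 2 / 4) ≤ inner ℝ (D.meanGradient w' - g) g := by
    have h1 := abs_real_inner_le_norm (D.meanGradient w' - g) g
    have h2 := mul_le_mul_of_nonneg_right hE2 (norm_nonneg g)
    linarith [neg_abs_le (inner ℝ (D.meanGradient w' - g) g)]
  have hi2 : inner ℝ (D.meanGradient w') (w' - w + (K : ℝ) • g) ≤ 5 / 16 * K * ‖g‖ ^ 2 := by
    refine (real_inner_le_norm _ _).trans ?_
    calc _ ≤ (5 / 4 * ‖g‖) * (K * ‖g‖ / 4) :=
          mul_le_mul hn hE1' (norm_nonneg _) (by positivity)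
      _ = _ := by ring
  have hi1' := mul_le_mul_of_nonneg_left hi1 hK0
  have : 0 ≤ (K : ℝ) * ‖g‖ ^ 2 := by positivity
  linarith

/-- Below the loss threshold, the local losses change by a constant factor during a round. -/
lemma mul_objective_le_roundLoss_one (hx : ∀ m i, ‖D.x m i‖ ≤ 1) (hK : 0 < K) (hμ1 : μ ≤ 1)
    {w : Vec d} (hw : 16 * K * M * D.objective w ≤ μ) :
    K * D.objective w ≤ 2 * D.roundLoss 1 K w := by
  have hslope := localSlope_le_of_objective_le hK hμ1 hw
  have hk : ∀ k ∈ Finset.range K, D.objective w / 2 ≤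
      (1 / (M : ℝ)) * ∑ m, D.localObjective m ((D.localStep 1 m)^[k] w) := by
    intro k hk
    have hm : ∀ m, D.localObjective m w / 2 ≤ D.localObjective m ((D.localStep 1 m)^[k] w) := by
      intro m
      have hG := localSlope_nonneg (D := D) m w
      have hkK : (k : ℝ) ≤ K := by exact_mod_cast (Finset.mem_range.1 hk).le
      have hkG := mul_le_mul_of_nonneg_right hkK hG
      have hKG : 0 ≤ (K : ℝ) * D.localSlope m w := by positivity
      have hmove := norm_iterate_localStep_one_sub_le hx m w (k := k) (by linarith [hslope m])
      rw [norm_sub_rev] at hmove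
      have he := exp_sub_one_le_two_mul (norm_nonneg _) hmove (by linarith [hslope m])
      have hl := localObjective_le_exp_mul hx m w ((D.localStep 1 m)^[k] w)
      have h0 := localObjective_nonneg (D := D) m ((D.localStep 1 m)^[k] w)
      have he2 : Real.exp ‖w - (D.localStep 1 m)^[k] w‖ ≤ 2 := by linarith [hslope m]
      linarith [mul_le_mul_of_nonneg_right he2 h0]
    unfold objective
    rw [mul_div_assoc, Finset.sum_div]
    exact mul_le_mul_of_nonneg_left (Finset.sum_le_sum fun m _ => hm m) (by positivity)
  have := Finset.sum_le_sum hk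
  rw [Finset.sum_const, Finset.card_range, nsmul_eq_mul] at this
  unfold roundLoss
  linarith

/-- At `k = 0` all clients still hold the global model, so their average is that model. -/
lemma localGD_lastRoundWeights (hM : 0 < M) (hK : 0 < K) (w : Vec d) (η : ℝ) (T : ℕ) :
    D.localGD w (T + 1) K η (lastRoundWeights (T + 1)) = D.globalModel w K η T := by
  have hM' : (M : ℝ) ≠ 0 := by positivity
  unfold localGD
  rw [Finset.sum_eq_single T, Finset.sum_eq_single 0]
  · simp [lastRoundWeights, averageAfter, ← Nat.cast_smul_eq_nsmul ℝ, smul_smul, hM']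
  · intro k _ hk
    simp [lastRoundWeights, hk]
  · simp [hK.ne']
  · intro r _ hr
    simp [lastRoundWeights, hr]
  · simp

/-- The loss after the second stage, relative to a comparator `u`. -/
lemma objective_globalModel_one_le (hx : ∀ m i, ‖D.x m i‖ ≤ 1) (hM : 0 < M) (hK : 0 < K)
    (hv1 : ‖v‖ = 1) (hv : ∀ m i, μ ≤ D.y m i * inner ℝ v (D.x m i)) (hμ1 : μ ≤ 1)
    {w : Vec d} (hw : 16 * K * M * D.objective w ≤ μ) (u : Vec d) (T : ℕ) :
    D.objective (D.globalModel w K 1 T) ≤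
      2 * ‖w - u‖ ^ 2 / (K * (T + 1)) + 4 * D.objective u := by
  have hsucc : ∀ r, D.globalModel w K 1 (r + 1) = D.averageAfter 1 K (D.globalModel w K 1 r) :=
    fun r => Function.iterate_succ_apply' _ _ _
  have hsmall : ∀ r, 16 * K * M * D.objective (D.globalModel w K 1 r) ≤ μ := by
    intro r
    induction r with
    | zero => exact hw
    | succ r ih =>
      rw [hsucc]
      exact (mul_le_mul_of_nonneg_left (objective_averageAfter_one_le hx hM hK hv1 hv hμ1 ih)
        (by positivity)).trans ih
  have hanti : Antitone fun r => D.objective (D.globalModel w K 1 r) := by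
    refine antitone_nat_of_succ_le fun r => ?_
    rw [hsucc]
    exact objective_averageAfter_one_le hx hM hK hv1 hv hμ1 (hsmall r)
  -- The regret covers `T + 1` rounds: the round starting from model `T` is charged too, so the
  -- bound makes sense for `T = 0`.
  have hreg := norm_globalModel_sub_sq_le hx hM zero_le_one le_rfl w u K (T + 1)
  have hlow : ∀ r ∈ Finset.range (T + 1), K * D.objective (D.globalModel w K 1 T) / 2 ≤
      D.roundLoss 1 K (D.globalModel w K 1 r) := by
    intro r hr
    have h1 := mul_objective_le_roundLoss_one hx hK hμ1 (hsmall r)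
    have h2 := mul_le_mul_of_nonneg_left (hanti (Finset.mem_range_succ_iff.1 hr))
      (Nat.cast_nonneg (α := ℝ) K)
    simp only at h2
    linarith
  have hsum := Finset.sum_le_sum hlow
  rw [Finset.sum_const, Finset.card_range, nsmul_eq_mul] at hsum
  have hKT : (0 : ℝ) < K * (T + 1) := by positivity
  push_cast at hreg hsum
  rw [div_add' _ _ _ hKT.ne', le_div_iff₀ hKT]
  linarith [sq_nonneg ‖D.globalModel w K 1 (T + 1) - u‖]

end Descent

end ClientData

/-! ### The maximum margin -/

namespace ClientData

variable {d M n : ℕ} {D : ClientData d M n}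

lemma margin_pos_and_le_one_and_exists (hx : ∀ m i, ‖D.x m i‖ ≤ 1) (hM : 0 < M) (hn : 0 < n)
    (hD : D.Separable) : 0 < D.margin ∧ D.margin ≤ 1 ∧
      ∃ v : Vec d, ‖v‖ = 1 ∧ ∀ m i, D.margin / 2 ≤ D.y m i * inner ℝ v (D.x m i) := by
  obtain ⟨w, hw⟩ := hD
  have s₀ : Fin M × Fin n := (⟨0, hM⟩, ⟨0, hn⟩)
  have : Nonempty (Fin M × Fin n) := ⟨s₀⟩
  have hbelow : ∀ v : Vec d, BddBelow (Set.range fun s : Fin M × Fin n =>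
      D.y s.1 s.2 * inner ℝ v (D.x s.1 s.2)) := fun v => (Set.finite_range _).bddBelow
  have hone : ∀ v : Metric.sphere (0 : Vec d) 1, (⨅ s : Fin M × Fin n,
      D.y s.1 s.2 * inner ℝ (v : Vec d) (D.x s.1 s.2)) ≤ 1 := by
    intro v
    refine (ciInf_le (hbelow v) s₀).trans ?_
    have h := abs_margin_sub_le hx s₀.1 s₀.2 (v : Vec d) 0
    rw [inner_zero_left, mul_zero, sub_zero, sub_zero, norm_eq_of_mem_sphere v] at h
    exact (le_abs_self _).trans h
  have habove : BddAbove (Set.range fun v : Metric.sphere (0 : Vec d) 1 => ⨅ s : Fin M × Fin n,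
      D.y s.1 s.2 * inner ℝ (v : Vec d) (D.x s.1 s.2)) := ⟨1, by rintro _ ⟨v, rfl⟩; exact hone v⟩
  have hw0 : w ≠ 0 := by
    rintro rfl
    simpa using hw s₀.1 s₀.2
  have hwn : 0 < ‖w‖ := norm_pos_iff.2 hw0
  have hunit : ‖w‖⁻¹ • w ∈ Metric.sphere (0 : Vec d) 1 := by
    rw [mem_sphere_zero_iff_norm, norm_smul, norm_inv, norm_norm, inv_mul_cancel₀ hwn.ne']
  have : Nonempty (Metric.sphere (0 : Vec d) 1) := ⟨⟨_, hunit⟩⟩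
  have hpos : 0 < D.margin := by
    refine lt_of_lt_of_le ?_ (le_ciSup habove ⟨_, hunit⟩)
    obtain ⟨s, hs⟩ := exists_eq_ciInf_of_finite (f := fun s : Fin M × Fin n =>
      D.y s.1 s.2 * inner ℝ (‖w‖⁻¹ • w) (D.x s.1 s.2))
    rw [← hs, real_inner_smul_left, mul_left_comm]
    exact mul_pos (inv_pos.2 hwn) (hw _ _)
  refine ⟨hpos, ciSup_le hone, ?_⟩
  -- Half the margin avoids showing that the supremum is attained, at the cost of constants only.
  obtain ⟨v, hv⟩ := exists_lt_of_lt_ciSup (half_lt_self hpos)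
  exact ⟨v, norm_eq_of_mem_sphere v, fun m i => hv.le.trans (ciInf_le (hbelow v) (m, i))⟩

end ClientData

/-! ### Scales and logarithmic factors -/

lemma one_le_logFactor {z : ℝ} (hz : 0 ≤ z) : 1 ≤ logFactor z := by
  rw [logFactor, Real.le_log_iff_exp_le (by positivity)]
  linarith

lemma logFactor_le_logFactor {y z : ℝ} (hy : 0 ≤ y) (h : y ≤ z) : logFactor y ≤ logFactor z :=
  Real.log_le_log (by positivity) (by linarith)

lemma log_le_mul_logFactor {A y z : ℝ} (hA : 1 ≤ A) (hz : 0 ≤ z) (hy : 0 < y)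
    (h : y ≤ A * (Real.exp 1 + z)) : Real.log y ≤ (Real.log A + 1) * logFactor z := by
  have h1 := Real.log_le_log hy h
  rw [Real.log_mul (by positivity) (by positivity)] at h1
  change _ ≤ _ + logFactor z at h1
  nlinarith [one_le_logFactor hz, Real.log_nonneg hA]

/-- Since `γ ≤ 1 ≤ K, M`, one has `γ² K^(2/3) ≤ K M^(1/3)`: the minimum is always its first term. -/
lemma stepScale_eq {K M : ℕ} {γ : ℝ} (hK : 0 < K) (hM : 0 < M) (hγ : 0 < γ) (hγ1 : γ ≤ 1) :
    stepScale K M γ = 1 / K := by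
  have hK1 : (1 : ℝ) ≤ K := by exact_mod_cast hK
  have hM1 : (1 : ℝ) ≤ M := by exact_mod_cast hM
  refine min_eq_left ?_
  rw [div_le_div_iff₀ (by positivity) (by positivity), one_mul]
  have h1 : (K : ℝ) ^ (2 / 3 : ℝ) ≤ K := by
    simpa using Real.rpow_le_rpow_of_exponent_le hK1 (show (2 / 3 : ℝ) ≤ 1 by norm_num)
  have h2 : (1 : ℝ) ≤ (M : ℝ) ^ (1 / 3 : ℝ) := Real.one_le_rpow hM1 (by norm_num)
  calc γ ^ 2 * (K : ℝ) ^ (2 / 3 : ℝ) ≤ 1 * K := by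
        gcongr
        exact pow_le_one₀ hγ.le hγ1
    _ ≤ (M : ℝ) ^ (1 / 3 : ℝ) * K := by gcongr

lemma le_warmupScale (K M : ℕ) {γ : ℝ} (hγ : 0 < γ) :
    (K : ℝ) * M / γ ^ 4 ≤ warmupScale K M γ :=
  le_add_of_nonneg_right (by positivity)

lemma warmupScale_le {K M : ℕ} {γ : ℝ} (hK : 0 < K) (hM : 0 < M) (hγ : 0 < γ) (hγ1 : γ ≤ 1) :
    warmupScale K M γ ≤ 2 * (K * M / γ ^ 4) := by
  have hKM : (1 : ℝ) ≤ (K : ℝ) * M := by exact_mod_cast Nat.mul_pos hK hM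
  have h1 : ((K : ℝ) * M) ^ (3 / 4 : ℝ) ≤ K * M := by
    simpa using Real.rpow_le_rpow_of_exponent_le hKM (show (3 / 4 : ℝ) ≤ 1 by norm_num)
  have h2 : γ ^ 4 ≤ γ ^ (5 / 2 : ℝ) := by
    rw [← Real.rpow_natCast]
    exact Real.rpow_le_rpow_of_exponent_ge hγ hγ1 (by norm_num)
  have : ((K : ℝ) * M) ^ (3 / 4 : ℝ) / γ ^ (5 / 2 : ℝ) ≤ K * M / γ ^ 4 := by gcongr
  unfold warmupScale
  linarith

/-! ### Both stages with explicit comparators -/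

namespace ClientData

variable {d M n : ℕ} {D : ClientData d M n} {K r₀ : ℕ} {η γ : ℝ} {v : Vec d}

lemma objective_log_smul_le (hγ : 0 < γ)
    (hv : ∀ m i, γ / 2 ≤ D.y m i * inner ℝ v (D.x m i)) {A : ℝ} (hA : 1 ≤ A) :
    D.objective ((2 / γ * Real.log A) • v) ≤ 1 / A := by
  have hlog := Real.log_nonneg hA
  refine (objective_smul_le (by positivity) hv).trans_eq ?_
  rw [show 2 / γ * Real.log A * (γ / 2) = Real.log A by field_simp, Real.exp_neg,
    Real.exp_log (by linarith), one_div]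

lemma norm_log_smul (hγ : 0 < γ) (hv1 : ‖v‖ = 1) {A : ℝ} (hA : 1 ≤ A) :
    ‖(2 / γ * Real.log A) • v‖ = 2 / γ * Real.log A := by
  have hlog := Real.log_nonneg hA
  rw [norm_smul, hv1, mul_one, Real.norm_of_nonneg (by positivity)]

/-- The first stage reaches the loss threshold below which the second stage descends. -/
lemma objective_warmup_le_threshold (hx : ∀ m i, ‖D.x m i‖ ≤ 1) (hM : 0 < M) (hK : 0 < K)
    (hr₀ : 0 < r₀) (h0 : 0 < η) (hηK : η * K ≤ 1) (hγ : 0 < γ) (hγ1 : γ ≤ 1) (hv1 : ‖v‖ = 1)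
    (hv : ∀ m i, γ / 2 ≤ D.y m i * inner ℝ v (D.x m i))
    (hlen : 512 * Real.exp 2 * Real.log (256 * Real.exp 2 * (K * M / γ)) ^ 2 * (K * M / γ ^ 3) ≤
      η * K * r₀) :
    16 * K * M * D.objective (D.localGD 0 r₀ K η (warmupWeights K r₀)) ≤ γ / 2 := by
  have hKM : (1 : ℝ) ≤ (K : ℝ) * M := by exact_mod_cast Nat.mul_pos hK hM
  have hz : 1 ≤ (K : ℝ) * M / γ := by rw [le_div_iff₀ hγ]; linarith
  have hE : 1 ≤ Real.exp 2 := Real.one_le_exp (by norm_num)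
  have hK' : (0 : ℝ) < K := by exact_mod_cast hK
  have hM' : (0 : ℝ) < M := by exact_mod_cast hM
  have hr' : (0 : ℝ) < r₀ := by exact_mod_cast hr₀
  -- With this `A`, the regret term and twice the comparator loss are each at most `γ/(128 exp 2 ·
  -- KM)`, and together they give exactly `γ/2`.
  set A := 256 * Real.exp 2 * (K * M / γ) with hAdef
  have hA : 1 ≤ A := by nlinarith
  have h := objective_localGD_warmupWeights_le hx hM hK hr₀ h0 hηK ((2 / γ * Real.log A) • v)
  rw [norm_log_smul hγ hv1 hA] at h
  have hF := objective_log_smul_le hγ hv hA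
  have h1 : (2 / γ * Real.log A) ^ 2 / (η * (K * r₀)) ≤ γ / (128 * Real.exp 2 * (K * M)) := by
    rw [div_le_div_iff₀ (by positivity) (by positivity)]
    have := mul_le_mul_of_nonneg_left hlen hγ.le
    refine le_trans (le_of_eq ?_) (this.trans_eq (by ring))
    field_simp
    ring
  have h2 : 1 / A = γ / (256 * Real.exp 2 * (K * M)) := by
    rw [hAdef]
    field_simp
  rw [h2] at hF
  have h3 : D.objective (D.localGD 0 r₀ K η (warmupWeights K r₀)) ≤
      2 * Real.exp 2 * (γ / (128 * Real.exp 2 * (K * M)) +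
        2 * (γ / (256 * Real.exp 2 * (K * M)))) := h.trans (by gcongr)
  calc _ ≤ 16 * K * M * (2 * Real.exp 2 * (γ / (128 * Real.exp 2 * (K * M)) +
        2 * (γ / (256 * Real.exp 2 * (K * M))))) := by gcongr
    _ = γ / 2 := by
      field_simp
      norm_num

/-- Convergence of the second stage, with explicit logarithms. -/
lemma objective_twoStageLocalGD_le (hx : ∀ m i, ‖D.x m i‖ ≤ 1) (hM : 0 < M) (hK : 0 < K)
    (hr₀ : 0 < r₀) (h0 : 0 < η) (hηK : η * K ≤ 1) (hγ : 0 < γ) (hγ1 : γ ≤ 1) (hv1 : ‖v‖ = 1)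
    (hv : ∀ m i, γ / 2 ≤ D.y m i * inner ℝ v (D.x m i))
    (hw : 16 * K * M * D.objective (D.localGD 0 r₀ K η (warmupWeights K r₀)) ≤ γ / 2)
    {ε : ℝ} (hε : 0 < ε) {R : ℕ} (hR : 2 * (r₀ : ℝ) ≤ R)
    (hRε : 32 * (Real.log (1 + 8 / ε) + 2 * Real.log (1 + r₀) + 1) ^ 2 *
      (1 / (γ ^ 2 * K * ε)) ≤ R) :
    D.objective (D.twoStageLocalGD 0 R K η 1 (warmupWeights K r₀) r₀) ≤ ε := by
  have hK' : (0 : ℝ) < K := by exact_mod_cast hK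
  have hr' : (0 : ℝ) < r₀ := by exact_mod_cast hr₀
  have hRr : 2 * r₀ ≤ R := by exact_mod_cast hR
  obtain ⟨T, hT⟩ : ∃ T, R - r₀ = T + 1 := ⟨R - r₀ - 1, by omega⟩
  have hTR : (R : ℝ) ≤ 2 * (T + 1) := by
    have : R ≤ 2 * (T + 1) := by omega
    exact_mod_cast this
  unfold twoStageLocalGD
  rw [hT, localGD_lastRoundWeights hM hK]
  set w := D.localGD 0 r₀ K η (warmupWeights K r₀)
  have h8 : 1 ≤ 1 + 8 / ε := by linarith [show 0 < 8 / ε by positivity]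
  have h1r : (1 : ℝ) ≤ 1 + r₀ := by linarith
  have hlogε := Real.log_nonneg h8
  have hlogr := Real.log_nonneg h1r
  -- Two comparators on one ray: `u` has loss at most `ε/8`, while `u'` has `r₀ F(u') ≤ 1`, as
  -- needed to locate the first stage's output. That may fail for `u`, so the distance to `u` goes
  -- through `u'`.
  set u := (2 / γ * Real.log (1 + 8 / ε)) • v with hu
  set u' := (2 / γ * Real.log (1 + r₀)) • v with hu'
  have hFu' : D.objective u' ≤ 1 / (1 + r₀) := objective_log_smul_le hγ hv h1r
  have hFu : D.objective u ≤ ε / 8 := by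
    refine (objective_log_smul_le hγ hv h8).trans ?_
    rw [div_le_div_iff₀ (by linarith) (by norm_num), mul_add, mul_div_cancel₀ _ hε.ne']
    linarith
  have hclose : ‖w - u'‖ ≤ ‖u'‖ + 2 := by
    refine norm_localGD_warmupWeights_sub_le hx hM hK hr₀ h0 hηK ?_
    refine (mul_le_mul_of_nonneg_left hFu' hr'.le).trans ?_
    rw [mul_one_div, div_le_one (by linarith)]
    linarith
  have hdist : ‖w - u‖ ≤ 2 / γ * (Real.log (1 + 8 / ε) + 2 * Real.log (1 + r₀) + 1) := by
    have h1 : ‖w - u‖ ≤ ‖w - u'‖ + (‖u'‖ + ‖u‖) := by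
      rw [← sub_add_sub_cancel w u' u]
      exact (norm_add_le _ _).trans (add_le_add_right (norm_sub_le _ _) _)
    have h2 : ‖u‖ = _ := norm_log_smul hγ hv1 h8
    have h3 : ‖u'‖ = _ := norm_log_smul hγ hv1 h1r
    have h4 : 2 ≤ 2 / γ := by rw [le_div_iff₀ hγ]; linarith
    rw [mul_add, mul_add]
    linarith
  have hfin := objective_globalModel_one_le hx hM hK hv1 hv (by linarith) hw u T
  set B := Real.log (1 + 8 / ε) + 2 * Real.log (1 + r₀) + 1
  have hsq : ‖w - u‖ ^ 2 ≤ (2 / γ * B) ^ 2 := pow_le_pow_left₀ (norm_nonneg _) hdist 2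
  have hmain : 2 * ‖w - u‖ ^ 2 / (K * (T + 1)) ≤ ε / 2 := by
    rw [div_le_div_iff₀ (by positivity) (by norm_num)]
    have h1 : (2 / γ * B) ^ 2 * 8 = 32 * B ^ 2 * (1 / (γ ^ 2 * K * ε)) * (K * ε) := by
      field_simp
      ring
    have h2 := mul_le_mul_of_nonneg_right (hRε.trans hTR) (show 0 ≤ K * ε by positivity)
    linarith
  linarith

end ClientData

/-! ### Sufficient numbers of rounds -/

/-- The factor of the number of rounds that suffices for a general number of local steps. -/
noncomputable def roundsConstant (C₁ : ℝ) (p₁ : ℕ) : ℝ :=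
  2 * C₁ + 32 * (Real.log 8 + 2 * (Real.log (1 + 2 * C₁) + (4 + p₁)) + 2) ^ 2

section Logarithms

variable {K M r₀ : ℕ} {γ ε C₁ : ℝ} {p₁ : ℕ}

/-- `1 + r₀` is at most a constant times the power `4 + p₁` of `exp 1 + KM/γ`: four from the scale,
`p₁` from its logarithmic factor. -/
lemma log_one_add_warmup_le (hK : 0 < K) (hM : 0 < M) (hγ : 0 < γ) (hγ1 : γ ≤ 1) (hC₁ : 0 < C₁)
    (hr : (r₀ : ℝ) ≤ C₁ * warmupScale K M γ * logFactor (K * M / γ) ^ p₁) :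
    Real.log (1 + r₀) ≤ (Real.log (1 + 2 * C₁) + (4 + p₁)) * logFactor (K * M / γ) := by
  have hKM : (1 : ℝ) ≤ (K : ℝ) * M := by exact_mod_cast Nat.mul_pos hK hM
  have hz : 0 ≤ (K : ℝ) * M / γ := by positivity
  set y := Real.exp 1 + K * M / γ with hy
  have hy1 : 1 ≤ y := by linarith [Real.one_le_exp zero_le_one]
  have hL1 := one_le_logFactor hz
  have hL : logFactor (K * M / γ) ≤ y := by
    have := Real.log_le_sub_one_of_pos (show 0 < y by linarith)
    change Real.log y ≤ y
    linarith
  have hX : warmupScale K M γ ≤ 2 * y ^ 4 := by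
    refine (warmupScale_le hK hM hγ hγ1).trans ?_
    have h1 : (K : ℝ) * M / γ ^ 4 ≤ (K * M / γ) ^ 4 := by
      rw [div_pow]
      gcongr
      exact le_self_pow₀ hKM (by norm_num)
    have h2 : ((K : ℝ) * M / γ) ^ 4 ≤ y ^ 4 :=
      pow_le_pow_left₀ hz (by linarith [Real.exp_pos 1]) 4
    linarith
  have hbound : (1 : ℝ) + r₀ ≤ (1 + 2 * C₁) * y ^ (4 + p₁) := by
    have h1 : (r₀ : ℝ) ≤ C₁ * (2 * y ^ 4) * y ^ p₁ := hr.trans (by gcongr)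
    have h2 : 1 ≤ y ^ (4 + p₁) := one_le_pow₀ hy1
    rw [pow_add] at h2 ⊢
    linarith
  have h := Real.log_le_log (by positivity) hbound
  rw [Real.log_mul (by positivity) (by positivity), Real.log_pow] at h
  change _ ≤ _ + _ * logFactor (K * M / γ) at h
  push_cast at h
  have := le_mul_of_one_le_right (Real.log_nonneg (show 1 ≤ 1 + 2 * C₁ by linarith)) hL1
  linarith

lemma log_one_add_div_le (hε : 0 < ε) {z : ℝ} (hz : 1 / ε ≤ z) :
    Real.log (1 + 8 / ε) ≤ (Real.log 8 + 1) * logFactor z := by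
  have h0 : 0 < 1 / ε := by positivity
  refine log_le_mul_logFactor (by norm_num) (by linarith) (by positivity) ?_
  have : 8 / ε = 8 * (1 / ε) := by ring
  linarith [Real.one_le_exp zero_le_one]

/-- The number of rounds for a general number of local steps is large enough for both stages. -/
lemma rounds_suffice (hK : 0 < K) (hM : 0 < M) (hγ : 0 < γ) (hγ1 : γ ≤ 1) (hε : 0 < ε)
    (hC₁ : 0 < C₁) (hr : (r₀ : ℝ) ≤ C₁ * warmupScale K M γ * logFactor (K * M / γ) ^ p₁) {R : ℝ}
    (hR : roundsConstant C₁ p₁ * logFactor (K * M / γ + 1 / ε) ^ (p₁ + 2) *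
      (warmupScale K M γ + 1 / (γ ^ 2 * K * ε)) ≤ R) :
    2 * (r₀ : ℝ) ≤ R ∧ 32 * (Real.log (1 + 8 / ε) + 2 * Real.log (1 + r₀) + 1) ^ 2 *
      (1 / (γ ^ 2 * K * ε)) ≤ R := by
  have hz : 0 ≤ (K : ℝ) * M / γ := by positivity
  have hε' : 0 < 1 / ε := by positivity
  have hX : 0 ≤ warmupScale K M γ := by unfold warmupScale; positivity
  have hY : 0 ≤ 1 / (γ ^ 2 * K * ε) := by positivity
  have hL1 := one_le_logFactor hz
  have hlog := log_one_add_warmup_le hK hM hγ hγ1 hC₁ hr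
  have hlog' := log_one_add_div_le hε (show 1 / ε ≤ K * M / γ + 1 / ε by linarith)
  have hLΛ : logFactor (K * M / γ) ≤ logFactor (K * M / γ + 1 / ε) :=
    logFactor_le_logFactor hz (by linarith)
  set L := logFactor (K * M / γ)
  set Λ := logFactor (K * M / γ + 1 / ε)
  set κ := Real.log 8 + 2 * (Real.log (1 + 2 * C₁) + (4 + p₁)) + 2 with hκ
  have hlogC : 0 ≤ Real.log (1 + 2 * C₁) := Real.log_nonneg (by linarith)
  have hlog8 : 0 ≤ Real.log 8 := Real.log_nonneg (by norm_num)
  have hΛ1 : 1 ≤ Λ := hL1.trans hLΛ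
  have hconst : roundsConstant C₁ p₁ = 2 * C₁ + 32 * κ ^ 2 := rfl
  have hr0 : (0 : ℝ) ≤ r₀ := Nat.cast_nonneg _
  rw [hconst] at hR
  constructor
  · refine le_trans ?_ hR
    calc 2 * (r₀ : ℝ) ≤ 2 * (C₁ * warmupScale K M γ * L ^ p₁) := by gcongr
      _ ≤ 2 * (C₁ * warmupScale K M γ * Λ ^ (p₁ + 2)) := by
          gcongr
          exact (pow_le_pow_left₀ (by linarith) hLΛ _).trans
            (pow_le_pow_right₀ hΛ1 (by omega))
      _ = (2 * C₁) * Λ ^ (p₁ + 2) * warmupScale K M γ := by ring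
      _ ≤ _ := by
          gcongr
          · linarith [show 0 ≤ 32 * κ ^ 2 by positivity]
          · linarith
  · refine le_trans ?_ hR
    have hB : Real.log (1 + 8 / ε) + 2 * Real.log (1 + r₀) + 1 ≤ κ * Λ := by
      have : (Real.log (1 + 2 * C₁) + (4 + p₁)) * L ≤ (Real.log (1 + 2 * C₁) + (4 + p₁)) * Λ := by
        gcongr
      rw [hκ]
      linarith
    have hB0 : 0 ≤ Real.log (1 + 8 / ε) + 2 * Real.log (1 + r₀) + 1 := by
      have h1 : 0 ≤ Real.log (1 + 8 / ε) :=
        Real.log_nonneg (by linarith [show 0 < 8 / ε by positivity])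
      have h2 : 0 ≤ Real.log (1 + (r₀ : ℝ)) := Real.log_nonneg (by linarith)
      linarith
    calc _ ≤ 32 * (κ * Λ) ^ 2 * (1 / (γ ^ 2 * K * ε)) := by gcongr
      _ = (32 * κ ^ 2) * Λ ^ 2 * (1 / (γ ^ 2 * K * ε)) := by ring
      _ ≤ _ := by
          gcongr
          · linarith
          · omega
          · linarith

/-- With the tuned number of local steps, the requirement on the number of rounds takes a form
that does not involve the number of local steps. -/
lemma tuned_rounds_le (hK : 0 < K) (hM : 0 < M) (hγ : 0 < γ) (hγ1 : γ ≤ 1) (hε : 0 < ε)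
    {a b : ℝ} (ha : 0 < a) (hb : 0 < b) (hKa : a * (γ / √(M * ε)) ≤ K)
    (hKb : K ≤ b * (γ / √(M * ε))) (p : ℕ) :
    logFactor (K * M / γ + 1 / ε) ^ p * (warmupScale K M γ + 1 / (γ ^ 2 * K * ε)) ≤
      (Real.log (2 + b) + 1) ^ p * (2 * b + 1 / a) * (logFactor (M / ε) ^ p *
        ((M : ℝ) ^ (1 / 2 : ℝ) / (γ ^ 3 * ε ^ (1 / 2 : ℝ)) +
          1 / (γ ^ (7 / 4 : ℝ) * ε ^ (3 / 8 : ℝ)))) := by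
  have hM1 : (1 : ℝ) ≤ M := by exact_mod_cast hM
  have hM0 : (0 : ℝ) < M := by linarith
  have hK0 : (0 : ℝ) < K := by exact_mod_cast hK
  rw [Real.sqrt_mul hM0.le] at hKa hKb
  have hsM : 0 < √(M : ℝ) := Real.sqrt_pos.2 hM0
  have hsε : 0 < √ε := Real.sqrt_pos.2 hε
  have hM2 : √(M : ℝ) * √M = M := Real.mul_self_sqrt hM0.le
  have hε2 : √ε * √ε = ε := Real.mul_self_sqrt hε.le
  rw [← Real.sqrt_eq_rpow, ← Real.sqrt_eq_rpow]
  have hKM : (K : ℝ) * M / γ ≤ b * (√M / √ε) := by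
    rw [div_le_iff₀ hγ]
    calc (K : ℝ) * M ≤ b * (γ / (√M * √ε)) * (√M * √M) := by rw [hM2]; gcongr
      _ = _ := by field_simp
  -- This is `t ≤ 1 + t²`; it puts `√(M/ε)` inside `logFactor (M / ε)`.
  have hsq : √(M : ℝ) / √ε ≤ 1 + M / ε := by
    have h1 : M / ε = (√(M : ℝ) / √ε) ^ 2 := by
      rw [div_pow, Real.sq_sqrt hM0.le, Real.sq_sqrt hε.le]
    rw [h1]
    nlinarith [sq_nonneg (√(M : ℝ) / √ε - 1), show 0 < √(M : ℝ) / √ε by positivity]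
  have hz : 0 ≤ (K : ℝ) * M / γ := by positivity
  have hε' : 0 < 1 / ε := by positivity
  have hMε : 1 / ε ≤ M / ε := by gcongr
  have hlogF : logFactor (K * M / γ + 1 / ε) ≤ (Real.log (2 + b) + 1) * logFactor (M / ε) := by
    refine log_le_mul_logFactor (by linarith) (by positivity) (by positivity) ?_
    have h1 := Real.one_le_exp zero_le_one
    have h2 : b * (√M / √ε) ≤ b * (Real.exp 1 + M / ε) := by
      gcongr
      linarith
    linarith
  have hterm1 : warmupScale K M γ ≤ 2 * b * (√M / (γ ^ 3 * √ε)) := by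
    refine (warmupScale_le hK hM hγ hγ1).trans ?_
    calc 2 * ((K : ℝ) * M / γ ^ 4) = 2 * (K * M / γ) / γ ^ 3 := by field_simp
      _ ≤ 2 * (b * (√M / √ε)) / γ ^ 3 := by gcongr
      _ = _ := by field_simp
  have hterm2 : 1 / (γ ^ 2 * K * ε) ≤ 1 / a * (√M / (γ ^ 3 * √ε)) := by
    calc 1 / (γ ^ 2 * K * ε) ≤ 1 / (γ ^ 2 * (a * (γ / (√M * √ε))) * (√ε * √ε)) := by
          rw [hε2]; gcongr
      _ = _ := by field_simp
  have hrest : 0 ≤ 1 / (γ ^ (7 / 4 : ℝ) * ε ^ (3 / 8 : ℝ)) := by positivity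
  have hsum : warmupScale K M γ + 1 / (γ ^ 2 * K * ε) ≤ (2 * b + 1 / a) *
      (√M / (γ ^ 3 * √ε) + 1 / (γ ^ (7 / 4 : ℝ) * ε ^ (3 / 8 : ℝ))) := by
    have : 0 ≤ (2 * b + 1 / a) * (1 / (γ ^ (7 / 4 : ℝ) * ε ^ (3 / 8 : ℝ))) := by positivity
    linarith
  have hX : 0 ≤ warmupScale K M γ := by unfold warmupScale; positivity
  have hΛ := one_le_logFactor (show 0 ≤ (K : ℝ) * M / γ + 1 / ε by positivity)
  calc _ ≤ ((Real.log (2 + b) + 1) * logFactor (M / ε)) ^ p * ((2 * b + 1 / a) *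
      (√M / (γ ^ 3 * √ε) + 1 / (γ ^ (7 / 4 : ℝ) * ε ^ (3 / 8 : ℝ)))) :=
        mul_le_mul (pow_le_pow_left₀ (by linarith) hlogF p) hsum (by positivity)
          (pow_nonneg (by linarith) p)
    _ = _ := by rw [mul_pow]; ring

/-- The length and the step size of the first stage make its regret bound small enough. -/
lemma warmup_length_suffices (hK : 0 < K) (hM : 0 < M) (hγ : 0 < γ) (hγ1 : γ ≤ 1) {c' η : ℝ}
    (hc' : 0 < c') {q : ℕ} (hη : c' * (1 / K) / logFactor (K * M / γ) ^ q ≤ η)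
    (hr : 512 * Real.exp 2 * (Real.log (256 * Real.exp 2) + 1) ^ 2 / c' * warmupScale K M γ *
      logFactor (K * M / γ) ^ (q + 2) ≤ r₀) :
    512 * Real.exp 2 * Real.log (256 * Real.exp 2 * (K * M / γ)) ^ 2 * (K * M / γ ^ 3) ≤
      η * K * r₀ := by
  have hK0 : (0 : ℝ) < K := by exact_mod_cast hK
  have hKM : (1 : ℝ) ≤ (K : ℝ) * M := by exact_mod_cast Nat.mul_pos hK hM
  have hz : 1 ≤ (K : ℝ) * M / γ := by rw [le_div_iff₀ hγ]; linarith
  have hE : 1 ≤ Real.exp 2 := Real.one_le_exp (by norm_num)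
  have hL1 := one_le_logFactor (zero_le_one.trans hz)
  have hlog : Real.log (256 * Real.exp 2 * (K * M / γ)) ≤
      (Real.log (256 * Real.exp 2) + 1) * logFactor (K * M / γ) := by
    refine log_le_mul_logFactor (by linarith) (by positivity) (by positivity) ?_
    gcongr
    linarith [Real.exp_pos 1]
  have hlog0 : 0 ≤ Real.log (256 * Real.exp 2 * (K * M / γ)) := Real.log_nonneg (by nlinarith)
  set κ := Real.log (256 * Real.exp 2) + 1
  set L := logFactor (K * M / γ)
  have hscale : (K : ℝ) * M / γ ^ 3 ≤ warmupScale K M γ := by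
    refine le_trans ?_ (le_warmupScale K M hγ)
    have : γ ^ 4 ≤ γ ^ 3 := pow_le_pow_of_le_one hγ.le hγ1 (by norm_num)
    gcongr
  have hX : 0 ≤ warmupScale K M γ := by unfold warmupScale; positivity
  calc _ ≤ 512 * Real.exp 2 * (κ * L) ^ 2 * warmupScale K M γ := by gcongr
    -- The power `q + 2` pays for the `L ^ q` lost in the step size and for the squared logarithm of
    -- the comparator's norm.
    _ = (c' * (1 / K) / L ^ q) * K *
        (512 * Real.exp 2 * κ ^ 2 / c' * warmupScale K M γ * L ^ (q + 2)) := by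
      rw [pow_add]
      field_simp
    _ ≤ η * K * r₀ := by
      have : 0 ≤ η := le_trans (by positivity) hη
      gcongr

end Logarithms

end TwoStageLocalGD

/-! ### Choice of constants and conclusion -/

theorem corollary3 :
    ∃ c > (0 : ℝ), ∀ c' > (0 : ℝ), ∀ q : ℕ,
    ∃ C₀ > (0 : ℝ), ∃ p₀ : ℕ, ∀ C₁ > (0 : ℝ), ∀ p₁ : ℕ, ∀ a > (0 : ℝ), ∀ b > (0 : ℝ),
    ∃ C > (0 : ℝ), ∃ p : ℕ,
      ∀ (d M n : ℕ) (D : TwoStageLocalGD.ClientData d M n) (K r₀ R : ℕ) (η₁ ε γ : ℝ),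
        0 < M → 0 < n → 0 < K → 0 < ε →
        (∀ m i, ‖D.x m i‖ ≤ 1) → D.Separable → γ = D.margin →
        -- the first step size is of the order of `stepScale`, up to logarithmic factors
        c' * TwoStageLocalGD.stepScale K M γ /
            TwoStageLocalGD.logFactor (K * M / γ) ^ q ≤ η₁ →
        η₁ ≤ c * TwoStageLocalGD.stepScale K M γ →
        -- the first stage is of the order of `warmupScale`, up to logarithmic factors
        C₀ * TwoStageLocalGD.warmupScale K M γ *
            TwoStageLocalGD.logFactor (K * M / γ) ^ p₀ ≤ r₀ →
        (r₀ : ℝ) ≤ C₁ * TwoStageLocalGD.warmupScale K M γ *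
            TwoStageLocalGD.logFactor (K * M / γ) ^ p₁ →
        -- the requirement on the number of rounds for a general number of local steps
        (C * TwoStageLocalGD.logFactor (K * M / γ + 1 / ε) ^ p *
              (TwoStageLocalGD.warmupScale K M γ + 1 / (γ ^ 2 * K * ε)) ≤ R →
          D.objective (D.twoStageLocalGD 0 R K η₁ 1
            (TwoStageLocalGD.warmupWeights K r₀) r₀) ≤ ε) ∧
        -- the requirement on the number of rounds for the tuned number of local steps
        (a * (γ / √(M * ε)) ≤ K → K ≤ b * (γ / √(M * ε)) →
          C * TwoStageLocalGD.logFactor (M / ε) ^ p *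
              ((M : ℝ) ^ (1 / 2 : ℝ) / (γ ^ 3 * ε ^ (1 / 2 : ℝ)) +
                1 / (γ ^ (7 / 4 : ℝ) * ε ^ (3 / 8 : ℝ))) ≤ R →
          D.objective (D.twoStageLocalGD 0 R K η₁ 1
            (TwoStageLocalGD.warmupWeights K r₀) r₀) ≤ ε) := by
  -- The upper constant is `1` because only `η₁ K ≤ 1` is needed.
  refine ⟨1, one_pos, fun c' hc' q => ⟨512 * Real.exp 2 * (Real.log (256 * Real.exp 2) + 1) ^ 2 / c',
    ?_, q + 2, fun C₁ hC₁ p₁ a ha b hb => ?_⟩⟩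
  · have : 0 ≤ Real.log (256 * Real.exp 2) :=
      Real.log_nonneg (by linarith [Real.one_le_exp (zero_le_two (α := ℝ))])
    positivity
  have hlogb : 0 ≤ Real.log (2 + b) := Real.log_nonneg (by linarith)
  have hlogC : 0 ≤ Real.log (1 + 2 * C₁) := Real.log_nonneg (by linarith)
  have hlog8 : 0 ≤ Real.log 8 := Real.log_nonneg (by norm_num)
  have hC : 0 < TwoStageLocalGD.roundsConstant C₁ p₁ := by
    unfold TwoStageLocalGD.roundsConstant
    positivity
  -- The summand `1` serves the general case, the other summand the loss incurred by eliminating `K`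
  -- in the tuned case.
  refine ⟨TwoStageLocalGD.roundsConstant C₁ p₁ *
    (1 + (Real.log (2 + b) + 1) ^ (p₁ + 2) * (2 * b + 1 / a)), by positivity, p₁ + 2, ?_⟩
  intro d M n D K r₀ R η₁ ε γ hM hn hK hε hx hsep hγdef hη hη' hr hr'
  obtain ⟨hγ, hγ1, v, hv1, hv⟩ :=
    TwoStageLocalGD.ClientData.margin_pos_and_le_one_and_exists hx hM hn hsep
  rw [← hγdef] at hγ hγ1 hv
  rw [TwoStageLocalGD.stepScale_eq hK hM hγ hγ1] at hη hη'
  have hK0 : (0 : ℝ) < K := by exact_mod_cast hK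
  have hM0 : (0 : ℝ) < M := by exact_mod_cast hM
  have hX : 0 < TwoStageLocalGD.warmupScale K M γ := by
    unfold TwoStageLocalGD.warmupScale
    positivity
  have hL := TwoStageLocalGD.one_le_logFactor (show 0 ≤ (K : ℝ) * M / γ by positivity)
  have hη0 : 0 < η₁ := lt_of_lt_of_le (by positivity) hη
  have hηK : η₁ * K ≤ 1 := by
    rw [one_mul, le_div_iff₀ hK0] at hη'
    exact hη'
  have hr₀ : 0 < r₀ := by
    have hlog : 0 ≤ Real.log (256 * Real.exp 2) :=
      Real.log_nonneg (by linarith [Real.one_le_exp (zero_le_two (α := ℝ))])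
    have : (0 : ℝ) < r₀ := lt_of_lt_of_le (by positivity) hr
    exact_mod_cast this
  have hthreshold := TwoStageLocalGD.ClientData.objective_warmup_le_threshold hx hM hK hr₀ hη0 hηK
    hγ hγ1 hv1 hv (TwoStageLocalGD.warmup_length_suffices hK hM hγ hγ1 hc' hη hr)
  have hgeneral : TwoStageLocalGD.roundsConstant C₁ p₁ *
      TwoStageLocalGD.logFactor (K * M / γ + 1 / ε) ^ (p₁ + 2) *
        (TwoStageLocalGD.warmupScale K M γ + 1 / (γ ^ 2 * K * ε)) ≤ R →
      D.objective (D.twoStageLocalGD 0 R K η₁ 1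
        (TwoStageLocalGD.warmupWeights K r₀) r₀) ≤ ε := by
    intro hR
    obtain ⟨h1, h2⟩ := TwoStageLocalGD.rounds_suffice hK hM hγ hγ1 hε hC₁ hr' hR
    exact TwoStageLocalGD.ClientData.objective_twoStageLocalGD_le hx hM hK hr₀ hη0 hηK hγ hγ1 hv1 hv
      hthreshold hε h1 h2
  have hconst : 0 ≤ (Real.log (2 + b) + 1) ^ (p₁ + 2) * (2 * b + 1 / a) := by positivity
  refine ⟨fun hR => hgeneral (le_trans ?_ hR), fun hKa hKb hR => hgeneral (le_trans ?_ hR)⟩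
  · have := TwoStageLocalGD.one_le_logFactor (show 0 ≤ (K : ℝ) * M / γ + 1 / ε by positivity)
    gcongr
    exact le_mul_of_one_le_right hC.le (by linarith)
  · have h := TwoStageLocalGD.tuned_rounds_le hK hM hγ hγ1 hε ha hb hKa hKb (p₁ + 2)
    have hL' := TwoStageLocalGD.one_le_logFactor (show 0 ≤ (M : ℝ) / ε by positivity)
    rw [mul_assoc]
    refine (mul_le_mul_of_nonneg_left h hC.le).trans ?_
    rw [← mul_assoc, mul_assoc (TwoStageLocalGD.roundsConstant C₁ p₁ * (1 + _))]
    gcongr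
    linarith
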